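/- Let $d\ge 0$ be an integer and $T>0$. Let $\mathcal C$ be the space of Borel vector fields $V:\,]0,T[\,\times\mathbb R^d\to\mathbb R^d$ such that $V_t=V(t,\cdot)$ is continuous for each $t$ and $\|V\|_c:=\int_0^T\|V_t\|_\infty\,dt<\infty$, where $\|V_t\|_\infty=\sup_x|V(t,x)|$; it is endowed with $\|\cdot\|_c$ (a norm once fields that coincide for almost every $t$ are identified). A solution of (ODE) $\dot\gamma(t)=V(t,\gamma(t))$ is an absolutely continuous curve $\gamma:[0,T]\to\mathbb R^d$ satisfying the equation for almost every $t$. A solution of (PDE) $\partial_t\mu_t+\operatorname{div}(V_t\mu_t)=0$ is a curve $t\in[0,T]\mapsto\mu_t$ of finite signed Borel measures on $\mathbb R^d$ that is weakly-$*$ continuous in duality with $C_0(\mathbb R^d)$ and such that, for each compactly supported smooth $u:\mathbb R^d\to\mathbb R$, the function $t\mapsto\int u\,d\mu_t$ is absolutely continuous on $[0,T]$ with derivative $\int du_x(V(t,x))\,d\mu_t(x)$ for almost every $t$. It is norm-bounded if the total variation $\|\mu_t\|$ is bounded on $[0,T]$. A flow of solutions of (ODE) is a Borel map $X:[0,T]\times[0,T]\times\mathbb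 R^d\to\mathbb R^d$, $(t,s,x)\mapsto X(t,s,x)=X_t^s(x)$, such that for all $t$ and $x$ the curve $s\mapsto X(t,s,x)$ is the only solution $\gamma$ of (ODE) with $\gamma(t)=x$. The flow $X$ uniquely solves (PDE) if, for each $S\in[0,T]$ and each finite signed Borel measure $\mu$, the curve $t\mapsto(X_S^t)_\sharp\mu$ is a norm-bounded solution of (PDE) with value $\mu$ at time $S$, and is the only one. Theorem. The space $\mathcal C$ is complete (so that it is a Banach space after the above identification), and the set of those $V\in\mathcal C$ for which there exists a flow of solutions of (ODE) that uniquely solves (PDE) is residual in $\mathcal C$, that is, it contains a countable intersection of dense open subsets of $\mathcal C$ (and hence a dense $G_\delta$). -/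

import Mathlib

open MeasureTheory Set Topology
open scoped ENNReal NNReal ContDiff ZeroAtInfty

noncomputable section

namespace GenericFlow

/-- The space `ℝ^d` with its Euclidean norm. -/
abbrev Rd (d : ℕ) : Type := EuclideanSpace ℝ (Fin d)

/-- The sup norm `‖V_t‖_∞ ∈ [0, ∞]` of a map `ℝ^d → ℝ^d`. -/
def supNorm {d : ℕ} (v : Rd d → Rd d) : ℝ≥0∞ := ⨆ x, ‖v x‖ₑ

/-- The quantity `‖V‖_c = ∫_0^T ‖V_t‖_∞ dt ∈ [0, ∞]`. -/
def cNorm {d : ℕ} (T : ℝ) (V : ℝ → Rd d → Rd d) : ℝ≥0∞ :=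
  ∫⁻ t in Ioo 0 T, supNorm (V t)

theorem supNorm_zero {d : ℕ} : supNorm (0 : Rd d → Rd d) = 0 := by
  simp [supNorm]

theorem supNorm_add_le {d : ℕ} (v w : Rd d → Rd d) :
    supNorm (v + w) ≤ supNorm v + supNorm w := by
  refine iSup_le fun x => (enorm_add_le _ _).trans ?_
  exact add_le_add (le_iSup (fun x => ‖v x‖ₑ) x) (le_iSup (fun x => ‖w x‖ₑ) x)

theorem supNorm_smul {d : ℕ} (c : ℝ) (v : Rd d → Rd d) :
    supNorm (c • v) = ‖c‖ₑ * supNorm v := by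
  simp [supNorm, enorm_smul, ENNReal.mul_iSup]

/-- For a Borel field which is continuous in `x`, the function `t ↦ ‖V_t‖_∞` is Borel. -/
theorem measurable_supNorm {d : ℕ} {V : ℝ → Rd d → Rd d}
    (hm : Measurable (Function.uncurry V)) (hc : ∀ t, Continuous (V t)) :
    Measurable fun t => supNorm (V t) := by
  have h : (fun t => supNorm (V t)) =
      fun t => ⨆ n : ℕ, ‖V t (TopologicalSpace.denseSeq (Rd d) n)‖ₑ := by
    funext t
    refine le_antisymm (iSup_le fun x => ?_) (iSup_le fun n => le_iSup (fun x => ‖V t x‖ₑ) _)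
    have hcl : IsClosed {x : Rd d | ‖V t x‖ₑ ≤
        ⨆ n : ℕ, ‖V t (TopologicalSpace.denseSeq (Rd d) n)‖ₑ} :=
      isClosed_le (hc t).enorm continuous_const
    refine (TopologicalSpace.denseRange_denseSeq (Rd d)).induction_on x hcl fun n => ?_
    exact le_iSup (fun n : ℕ => ‖V t (TopologicalSpace.denseSeq (Rd d) n)‖ₑ) n
  rw [h]
  refine Measurable.iSup fun n => Measurable.enorm ?_
  exact hm.comp (measurable_id.prodMk measurable_const)

/-- The vector space of Borel vector fields `V : ]0,T[ × ℝ^d → ℝ^d` such that `V_t` is continuous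
for each `t` and `∫_0^T ‖V_t‖_∞ dt < ∞`. A field on `]0,T[ × ℝ^d` is encoded by its extension by
zero to `ℝ × ℝ^d`. -/
def fields (d : ℕ) (T : ℝ) : Submodule ℝ (ℝ → Rd d → Rd d) where
  carrier := {V | Measurable (Function.uncurry V) ∧ (∀ t, Continuous (V t)) ∧
    (∀ t, t ∉ Ioo 0 T → V t = 0) ∧ cNorm T V < ⊤}
  zero_mem' := by
    refine ⟨measurable_const, fun t => continuous_const, fun t _ => rfl, ?_⟩
    simp [cNorm, supNorm]
  add_mem' := by
    rintro V W ⟨hV, hVc, hV0, hVn⟩ ⟨hW, hWc, hW0, hWn⟩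
    refine ⟨hV.add hW, fun t => (hVc t).add (hWc t), fun t ht => ?_, ?_⟩
    · simp [hV0 t ht, hW0 t ht]
    · calc cNorm T (V + W) ≤ ∫⁻ t in Ioo 0 T, (supNorm (V t) + supNorm (W t)) :=
            lintegral_mono fun t => supNorm_add_le _ _
        _ = cNorm T V + cNorm T W := lintegral_add_left (measurable_supNorm hV hVc) _
        _ < ⊤ := ENNReal.add_lt_top.2 ⟨hVn, hWn⟩
  smul_mem' := by
    rintro c V ⟨hV, hVc, hV0, hVn⟩
    refine ⟨hV.const_smul c, fun t => (hVc t).const_smul c, fun t ht => ?_, ?_⟩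
    · simp [hV0 t ht]
    · calc cNorm T (c • V) = ∫⁻ t in Ioo 0 T, ‖c‖ₑ * supNorm (V t) :=
            lintegral_congr fun t => supNorm_smul c (V t)
        _ = ‖c‖ₑ * cNorm T V := lintegral_const_mul _ (measurable_supNorm hV hVc)
        _ < ⊤ := ENNReal.mul_lt_top enorm_lt_top hVn

/-- The space `𝒞([0,T] × ℝ^d)`. It is a type of its own, so that it carries the topology of
`‖·‖_c` and not the topology of pointwise convergence. -/
def FieldSpace (d : ℕ) (T : ℝ) : Type := fields d T

namespace FieldSpace

variable {d : ℕ} {T : ℝ}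

instance : AddCommGroup (FieldSpace d T) := inferInstanceAs (AddCommGroup (fields d T))

instance : Module ℝ (FieldSpace d T) := inferInstanceAs (Module ℝ (fields d T))

instance : CoeFun (FieldSpace d T) fun _ => ℝ → Rd d → Rd d := ⟨fun V => V.val⟩

theorem cNorm_add_le (V W : FieldSpace d T) : cNorm T ⇑(V + W) ≤ cNorm T V + cNorm T W :=
  calc cNorm T ⇑(V + W) ≤ ∫⁻ t in Ioo 0 T, (supNorm (V t) + supNorm (W t)) :=
        lintegral_mono fun t => supNorm_add_le _ _
    _ = cNorm T V + cNorm T W :=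
        lintegral_add_left (measurable_supNorm V.property.1 V.property.2.1) _

theorem cNorm_smul (c : ℝ) (V : FieldSpace d T) : cNorm T ⇑(c • V) = ‖c‖ₑ * cNorm T V :=
  calc cNorm T ⇑(c • V) = ∫⁻ t in Ioo 0 T, ‖c‖ₑ * supNorm (V t) :=
        lintegral_congr fun t => supNorm_smul c (V t)
    _ = ‖c‖ₑ * cNorm T V :=
        lintegral_const_mul _ (measurable_supNorm V.property.1 V.property.2.1)

theorem cNorm_ne_top (V : FieldSpace d T) : cNorm T V ≠ ⊤ := V.property.2.2.2.ne

/-- The norm `V ↦ ‖V‖_c`. It vanishes exactly when `V_t = 0` for almost every `t`; as usual it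
is a norm up to the identification of fields which coincide for almost every `t`. -/
instance : SeminormedAddCommGroup (FieldSpace d T) :=
  AddGroupSeminorm.toSeminormedAddCommGroup
    { toFun := fun V => (cNorm T V).toReal
      map_zero' := by
        have h : cNorm T ⇑(0 : FieldSpace d T) = 0 :=
          (lintegral_congr fun _ => supNorm_zero).trans lintegral_zero
        rw [h, ENNReal.toReal_zero]
      add_le' := fun V W => by
        rw [← ENNReal.toReal_add (cNorm_ne_top V) (cNorm_ne_top W)]
        exact ENNReal.toReal_mono
          (ENNReal.add_ne_top.2 ⟨cNorm_ne_top V, cNorm_ne_top W⟩) (cNorm_add_le V W)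
      neg' := fun V => by
        have h := cNorm_smul (-1) V
        rw [neg_one_smul] at h
        rw [h]
        simp }

theorem norm_def (V : FieldSpace d T) : ‖V‖ = (cNorm T V).toReal := rfl

instance : NormedSpace ℝ (FieldSpace d T) where
  norm_smul_le c V := by
    rw [norm_def, norm_def, cNorm_smul, ENNReal.toReal_mul, toReal_enorm]

end FieldSpace

variable {d : ℕ}

/-- `γ` solves (ODE) on `[0,T]`: it is absolutely continuous on `[0,T]` and
`γ'(t) = V(t, γ(t))` for almost every `t`. Only the values of `γ` on `[0,T]` matter. -/
def IsODESolution (T : ℝ) (V : ℝ → Rd d → Rd d) (γ : ℝ → Rd d) : Prop :=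
  AbsolutelyContinuousOnInterval γ 0 T ∧
    ∀ᵐ t ∂(volume.restrict (Ioo 0 T)), HasDerivAt γ (V t (γ t)) t

/-- `t ↦ μ_t` solves (PDE) `∂_t μ_t + div (V_t μ_t) = 0` on `[0,T]`, in the space of finite signed
Borel measures: it is weakly-* continuous (against `C_0(ℝ^d)`) on `[0,T]` and, for each compactly
supported smooth `u`, the function `t ↦ ∫ u dμ_t` is absolutely continuous on `[0,T]` with
derivative `∫ du_x(V(t,x)) dμ_t(x)` at almost every `t`. Only the values of `μ` on `[0,T]`
matter. -/
def IsPDESolution (T : ℝ) (V : ℝ → Rd d → Rd d) (μ : ℝ → SignedMeasure (Rd d)) : Prop :=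
  (∀ f : C₀(Rd d, ℝ), ContinuousOn (fun t => ∫ᵛ x, f x ∂•(μ t)) (Icc 0 T)) ∧
    ∀ u : Rd d → ℝ, ContDiff ℝ ∞ u → HasCompactSupport u →
      AbsolutelyContinuousOnInterval (fun t => ∫ᵛ x, u x ∂•(μ t)) 0 T ∧
        ∀ᵐ t ∂(volume.restrict (Ioo 0 T)),
          HasDerivAt (fun s => ∫ᵛ x, u x ∂•(μ s)) (∫ᵛ x, fderiv ℝ u x (V t x) ∂•(μ t)) t

/-- The total variation norm `‖μ_t‖ = |μ_t|(ℝ^d)` is bounded on `[0,T]`. -/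
def NormBounded (T : ℝ) (μ : ℝ → SignedMeasure (Rd d)) : Prop :=
  ∃ C : ℝ≥0, ∀ t ∈ Icc 0 T, (μ t).variation univ ≤ C

/-- `X(t,s,x)` is a flow of solutions of (ODE): it is Borel on `[0,T] × [0,T] × ℝ^d` and, for
all `t ∈ [0,T]` and `x`, the curve `s ↦ X(t,s,x)` is the only solution of (ODE) with value `x`
at time `t`. -/
def IsFlow (T : ℝ) (V : ℝ → Rd d → Rd d) (X : ℝ → ℝ → Rd d → Rd d) : Prop :=
  Measurable (fun p : Icc (0 : ℝ) T × Icc (0 : ℝ) T × Rd d => X p.1 p.2.1 p.2.2) ∧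
    ∀ t ∈ Icc 0 T, ∀ x : Rd d,
      IsODESolution T V (fun s => X t s x) ∧ X t t x = x ∧
        ∀ γ : ℝ → Rd d, IsODESolution T V γ → γ t = x → ∀ s ∈ Icc 0 T, γ s = X t s x

/-- The flow `X` uniquely solves (PDE): for each `S ∈ [0,T]` and each finite signed measure `μ`,
the curve `t ↦ (X_S^t)_♯ μ` is the only norm-bounded solution of (PDE) equal to `μ` at time
`S`. -/
def UniquelySolvesPDE (T : ℝ) (V : ℝ → Rd d → Rd d) (X : ℝ → ℝ → Rd d → Rd d) : Prop :=
  ∀ S ∈ Icc 0 T, ∀ μ : SignedMeasure (Rd d),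
    (IsPDESolution T V (fun t => μ.map (X S t)) ∧ NormBounded T (fun t => μ.map (X S t)) ∧
      μ.map (X S S) = μ) ∧
    ∀ ν : ℝ → SignedMeasure (Rd d), IsPDESolution T V ν → NormBounded T ν → ν S = μ →
      ∀ t ∈ Icc 0 T, ν t = μ.map (X S t)

end GenericFlow

end

noncomputable section

namespace GenericFlow

open Filter

/-! ### Completeness of the space of fields -/

section

variable {d : ℕ} {T : ℝ}

/-! Generic fields are those approximated by smooth fields with an accuracy that depends on the
approximant. If `W` has Lipschitz constant K in space, Gronwall's inequality amplifies errors over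
[0,T] by a multiple of exp(2KT). `approxSet d T n` is a union of balls of radius exp(-2KT)/(n+1)
around fields that equal such a `W` on the ball of radius n. It is open by construction. It is dense
because sampling with a partition of unity approximates any field by centres of such balls, and a
centre belongs to its ball however small the radius is (`dense_approxSet`). The intersection over n
is therefore residual, and the theorem holds for every V in it.

For such V, replacing V by `W` along a curve in the ball of radius n costs at most exp(-2KT)/(n+1),
which cancels the amplification. Two approximate solutions of (ODE) with the same data and defects
η₁, η₂ thus stay within C(η₁+η₂) + 4/(n+1) of each other, where C depends on n (`exists_stability`).
Fixing n first and then letting the defects tend to 0 gives uniqueness, convergence of approximate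
solutions (Picard iterates for `W`), and continuity of the flow.

For (PDE), the chain rule along trajectories and Fubini's theorem show that push-forward by the flow
gives solutions. Uniqueness is by duality: a test function is carried from time t back to time S by
N Euler steps of `W`. Its Lipschitz constant grows by a factor at most exp(KT), so the approximation
of V by `W` contributes at most Mℓ/(n+1), where M bounds the total variations and ℓ the
differential, while all other errors are O(1/N) for fixed `W`. The function obtained at time S does
not depend on the solution, so two solutions that agree at S agree at t after N → ∞ and then n → ∞.

Completeness is independent of this: a sequence with summable increments converges uniformly in x
for almost every t. -/

theorem enorm_le_supNorm (v : Rd d → Rd d) (x : Rd d) : ‖v x‖ₑ ≤ supNorm v :=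
  le_iSup (fun x => ‖v x‖ₑ) x

theorem FieldSpace.ofReal_norm (V : FieldSpace d T) : ENNReal.ofReal ‖V‖ = cNorm T V :=
  ENNReal.ofReal_toReal (FieldSpace.cNorm_ne_top V)

theorem FieldSpace.measurable_supNorm (V : FieldSpace d T) : Measurable fun t => supNorm (V t) :=
  GenericFlow.measurable_supNorm V.property.1 V.property.2.1

/-- The element of `FieldSpace d T` given by a field. -/
def FieldSpace.ofMem (V : ℝ → Rd d → Rd d) (h : V ∈ fields d T) : FieldSpace d T := ⟨V, h⟩

theorem supNorm_sub_comm (v w : Rd d → Rd d) : supNorm (v - w) = supNorm (w - v) := by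
  unfold supNorm
  congr with x
  exact enorm_sub_rev _ _

/-- A sequence of fields whose increments have summable norms converges. -/
theorem exists_tendsto_of_summable_increments (V : ℕ → FieldSpace d T)
    (hV : Summable fun n => dist (V (n + 1)) (V n)) : ∃ W, Tendsto V atTop (𝓝 W) := by
  set D : ℕ → ℝ → ℝ≥0∞ := fun n t => supNorm (V n t - V (n + 1) t) with hD
  have hDm : ∀ n, Measurable (D n) := fun n =>
    FieldSpace.measurable_supNorm (V n - V (n + 1))
  have hsum : ∑' n, ∫⁻ t in Ioo 0 T, D n t ≠ ⊤ := by
    have h : ∀ n, ∫⁻ t in Ioo 0 T, D n t = ENNReal.ofReal (dist (V (n + 1)) (V n)) := fun n => by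
      rw [dist_comm, dist_eq_norm, FieldSpace.ofReal_norm]
      rfl
    simp_rw [h]
    exact hV.tsum_ofReal_ne_top
  -- Almost every time of ]0,T[ lies in `G`. The limit is set to 0 at the other times, so that every
  -- slice is continuous and not only almost every one.
  set G : Set ℝ := Ioo 0 T ∩ {t | ∑' n, D n t < ⊤} with hG
  have hGm : MeasurableSet G := measurableSet_Ioo.inter
    (measurableSet_lt (Measurable.tsum hDm) measurable_const)
  have hae : ∀ᵐ t ∂(volume.restrict (Ioo 0 T)), t ∈ G := by
    have h1 : ∫⁻ t in Ioo 0 T, ∑' n, D n t ≠ ⊤ := by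
      rwa [lintegral_tsum fun n => (hDm n).aemeasurable]
    filter_upwards [ae_lt_top (Measurable.tsum hDm) h1, ae_restrict_mem measurableSet_Ioo]
      with t h1 h2 using ⟨h2, h1⟩
  have hed : ∀ t x n, edist (V n t x) (V (n + 1) t x) ≤ D n t := fun t x n => by
    rw [edist_eq_enorm_sub]
    exact enorm_le_supNorm (V n t - V (n + 1) t) x
  have hlim : ∀ t ∈ G, ∀ x, ∃ y, Tendsto (fun n => V n t x) atTop (𝓝 y) := fun t ht x =>
    cauchySeq_tendsto_of_complete (cauchySeq_of_edist_le_of_tsum_ne_top _ (hed t x) ht.2.ne)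
  classical
  set W : ℝ → Rd d → Rd d := fun t x => if h : t ∈ G then (hlim t h x).choose else 0 with hW
  have hWlim : ∀ t ∈ G, ∀ x, Tendsto (fun n => V n t x) atTop (𝓝 (W t x)) := fun t ht x => by
    simp only [hW, dif_pos ht]
    exact (hlim t ht x).choose_spec
  have hW0 : ∀ t ∉ G, W t = 0 := fun t ht => by
    ext1 x
    simp only [hW, dif_neg ht, Pi.zero_apply]
  have hbd : ∀ t ∈ G, ∀ n, supNorm (V n t - W t) ≤ ∑' m, D (m + n) t := fun t ht n => by
    refine iSup_le fun x => ?_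
    rw [Pi.sub_apply, ← edist_eq_enorm_sub]
    simp_rw [add_comm _ n]
    exact edist_le_tsum_of_edist_le_of_tendsto _ (hed t x) (hWlim t ht x) n
  have htail : ∀ t ∈ G, Tendsto (fun n => ∑' m, D (m + n) t) atTop (𝓝 0) := fun t ht =>
    ENNReal.tendsto_sum_nat_add _ ht.2.ne
  have hWc : ∀ t, Continuous (W t) := fun t => by
    by_cases ht : t ∈ G
    · have hu : TendstoUniformly (fun n => V n t) (W t) atTop := by
        rw [EMetric.tendstoUniformly_iff]
        intro ε hε
        filter_upwards [(htail t ht).eventually (gt_mem_nhds hε)] with n hn x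
        rw [edist_comm, edist_eq_enorm_sub]
        exact ((enorm_le_supNorm (V n t - W t) x).trans (hbd t ht n)).trans_lt hn
      exact hu.continuous (Frequently.of_forall fun n => (V n).property.2.1 t)
    · rw [hW0 t ht]
      exact continuous_zero
  have hWm : Measurable (Function.uncurry W) := by
    refine measurable_of_tendsto_metrizable
      (f := fun n => (Prod.fst ⁻¹' G).indicator (Function.uncurry (V n)))
      (fun n => (V n).property.1.indicator (measurable_fst hGm)) ?_
    rw [tendsto_pi_nhds]
    rintro ⟨t, x⟩
    by_cases ht : t ∈ G
    · simpa [indicator, ht] using! hWlim t ht x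
    · simp [indicator, ht, hW0 t ht]
  have hcn : ∀ n, ∫⁻ t in Ioo 0 T, supNorm (V n t - W t) ≤
      ∑' m, ∫⁻ t in Ioo 0 T, D (m + n) t := fun n => by
    rw [← lintegral_tsum fun m => (hDm _).aemeasurable]
    refine lintegral_mono_ae ?_
    filter_upwards [hae] with t ht using hbd t ht n
  have hcn0 : ∫⁻ t in Ioo 0 T, supNorm (V 0 t - W t) < ⊤ :=
    (hcn 0).trans_lt hsum.lt_top
  have hWmem : W ∈ fields d T := by
    refine ⟨hWm, hWc, fun t ht => hW0 t fun h => ht h.1, ?_⟩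
    calc cNorm T W ≤ ∫⁻ t in Ioo 0 T, (supNorm (V 0 t) + supNorm (V 0 t - W t)) := by
          refine lintegral_mono fun t => ?_
          have := supNorm_add_le (V 0 t) (W t - V 0 t)
          rwa [add_sub_cancel, supNorm_sub_comm (W t)] at this
      _ = cNorm T (V 0) + ∫⁻ t in Ioo 0 T, supNorm (V 0 t - W t) :=
          lintegral_add_left (FieldSpace.measurable_supNorm _) _
      _ < ⊤ := ENNReal.add_lt_top.2 ⟨(FieldSpace.cNorm_ne_top _).lt_top, hcn0⟩
  refine ⟨FieldSpace.ofMem W hWmem, ?_⟩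
  rw [tendsto_iff_edist_tendsto_0]
  refine tendsto_of_tendsto_of_tendsto_of_le_of_le tendsto_const_nhds
    (ENNReal.tendsto_sum_nat_add _ hsum) (fun n => bot_le) fun n => ?_
  rw [edist_dist, dist_eq_norm, FieldSpace.ofReal_norm]
  exact hcn n

theorem completeSpace_fieldSpace : CompleteSpace (FieldSpace d T) := by
  refine Metric.complete_of_cauchySeq_tendsto fun u hu => ?_
  obtain ⟨f, hf, hs⟩ := Metric.exists_subseq_summable_dist_of_cauchySeq u hu
  obtain ⟨W, hW⟩ := exists_tendsto_of_summable_increments (fun n => u (f n)) hs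
  exact ⟨W, tendsto_nhds_of_cauchySeq_of_subseq hu hf.tendsto_atTop hW⟩

end

/-! ### Absolutely continuous curves and the integral form of (ODE) -/

section

variable {d : ℕ} {T : ℝ}

section AbsolutelyContinuous

variable {F : Type*} [NormedAddCommGroup F]

/-- The modulus of absolute continuity is that of the primitive of `g`. The absolute value around
the integral spares any ordering of `r` and `s`. -/
theorem absolutelyContinuousOnInterval_of_dist_le {X : Type*} [PseudoMetricSpace X]
    {f : ℝ → X} {g : ℝ → ℝ} {a b : ℝ}
    (hg : IntervalIntegrable g volume a b)
    (h : ∀ r ∈ uIcc a b, ∀ s ∈ uIcc a b, dist (f r) (f s) ≤ |∫ q in r..s, g q|) :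
    AbsolutelyContinuousOnInterval f a b := by
  have hG := hg.absolutelyContinuousOnInterval_intervalIntegral (c := a) left_mem_uIcc
  rw [absolutelyContinuousOnInterval_iff] at hG ⊢
  intro ε hε
  obtain ⟨δ, hδ, H⟩ := hG ε hε
  refine ⟨δ, hδ, fun E hE hl => lt_of_le_of_lt (Finset.sum_le_sum fun i hi => ?_) (H E hE hl)⟩
  obtain ⟨h1, h2⟩ := hE.1 i hi
  refine (h _ h1 _ h2).trans_eq ?_
  rw [dist_comm, Real.dist_eq, intervalIntegral.integral_interval_sub_left]
  · exact hg.mono_set (uIcc_subset_uIcc left_mem_uIcc h2)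
  · exact hg.mono_set (uIcc_subset_uIcc left_mem_uIcc h1)

variable [NormedSpace ℝ F]

theorem absolutelyContinuousOnInterval_intervalIntegral {g : ℝ → F} {a b c : ℝ}
    (hg : IntervalIntegrable g volume a b) (hc : c ∈ uIcc a b) :
    AbsolutelyContinuousOnInterval (fun s => ∫ q in c..s, g q) a b := by
  refine absolutelyContinuousOnInterval_of_dist_le hg.norm fun r hr s hs => ?_
  rw [dist_comm, dist_eq_norm, intervalIntegral.integral_interval_sub_left
    (hg.mono_set (uIcc_subset_uIcc hc hs)) (hg.mono_set (uIcc_subset_uIcc hc hr))]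
  exact intervalIntegral.norm_integral_le_abs_of_norm_le (Eventually.of_forall fun _ => le_rfl)
    (hg.norm.mono_set (uIcc_subset_uIcc hr hs))

variable [CompleteSpace F]

/-- The fundamental theorem of calculus for absolutely continuous curves whose derivative is almost
everywhere equal to an integrable function. -/
theorem AbsolutelyContinuousOnInterval.sub_eq_integral {f g : ℝ → F} {a b : ℝ}
    (hf : AbsolutelyContinuousOnInterval f a b) (hg : IntervalIntegrable g volume a b)
    (h : ∀ᵐ t, t ∈ uIcc a b → HasDerivAt f (g t) t) {r s : ℝ} (hr : r ∈ uIcc a b)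
    (hs : s ∈ uIcc a b) : f s - f r = ∫ q in r..s, g q := by
  have hG := absolutelyContinuousOnInterval_intervalIntegral hg (c := r) hr
  -- The difference of `f` and the primitive of `g` is absolutely continuous with derivative zero
  -- almost everywhere, hence constant.
  obtain ⟨C, hC⟩ := (hf.fun_sub hG).const_of_ae_hasDerivAt_zero (by
    filter_upwards [h, hg.ae_hasDerivAt_integral] with t h1 h2 ht
    simpa using! (h1 ht).sub (h2 ht r hr))
  have h1 := hC r hr
  have h2 := hC s hs
  rw [intervalIntegral.integral_same, sub_zero] at h1
  rw [← h1] at h2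
  rw [sub_eq_iff_eq_add'] at h2 ⊢
  rw [h2, add_comm]

theorem ae_hasDerivAt_of_sub_eq_integral {f g : ℝ → F} {a b : ℝ} (hab : a ≤ b)
    (hg : IntervalIntegrable g volume a b)
    (h : ∀ s ∈ Icc a b, f s - f a = ∫ q in a..s, g q) :
    ∀ᵐ t ∂(volume.restrict (Ioo a b)), HasDerivAt f (g t) t := by
  rw [ae_restrict_iff' measurableSet_Ioo]
  filter_upwards [hg.ae_hasDerivAt_integral] with t ht htI
  have h1 : t ∈ uIcc a b := by
    rw [uIcc_of_le hab]
    exact Ioo_subset_Icc_self htI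
  refine ((ht h1 a left_mem_uIcc).const_add (f a)).congr_of_eventuallyEq ?_
  filter_upwards [Ioo_mem_nhds htI.1 htI.2] with s hs
  rw [← h s (Ioo_subset_Icc_self hs), add_sub_cancel]

end AbsolutelyContinuous

theorem ae_uIcc_of_ae_Ioo {p : ℝ → Prop} (hT : 0 ≤ T)
    (h : ∀ᵐ t ∂(volume.restrict (Ioo 0 T)), p t) : ∀ᵐ t : ℝ, t ∈ uIcc 0 T → p t := by
  rw [uIcc_of_le hT, ← ae_restrict_iff' measurableSet_Icc]
  rwa [Measure.restrict_congr_set Ioo_ae_eq_Icc] at h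

namespace FieldSpace

/-- The sup norm `‖V_t‖_∞`, as a real number. -/
def speed (V : FieldSpace d T) (t : ℝ) : ℝ := (supNorm (V t)).toReal

variable (V : FieldSpace d T)

theorem speed_nonneg (t : ℝ) : 0 ≤ V.speed t := ENNReal.toReal_nonneg

theorem eq_zero_of_notMem {t : ℝ} (ht : t ∉ Ioo 0 T) : V t = 0 := V.property.2.2.1 t ht

theorem continuous_apply (t : ℝ) : Continuous (V t) := V.property.2.1 t

theorem lintegral_supNorm : ∫⁻ t, supNorm (V t) = cNorm T V := by
  refine (setLIntegral_eq_of_support_subset fun t ht => ?_).symm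
  by_contra h
  exact ht (by simp [V.eq_zero_of_notMem h, supNorm])

theorem ae_supNorm_lt_top : ∀ᵐ t, supNorm (V t) < ⊤ :=
  ae_lt_top V.measurable_supNorm (by
    rw [lintegral_supNorm]
    exact V.cNorm_ne_top)

theorem integrable_speed : Integrable V.speed :=
  integrable_toReal_of_lintegral_ne_top V.measurable_supNorm.aemeasurable (by
    rw [lintegral_supNorm]
    exact V.cNorm_ne_top)

theorem integral_speed : ∫ t, V.speed t = ‖V‖ := by
  rw [norm_def, ← lintegral_supNorm]
  exact integral_toReal V.measurable_supNorm.aemeasurable V.ae_supNorm_lt_top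

theorem norm_le_speed {t : ℝ} (ht : supNorm (V t) < ⊤) (x : Rd d) : ‖V t x‖ ≤ V.speed t := by
  rw [← toReal_enorm]
  exact ENNReal.toReal_mono ht.ne (enorm_le_supNorm _ x)

theorem ae_norm_le_speed : ∀ᵐ t, ∀ x, ‖V t x‖ ≤ V.speed t := by
  filter_upwards [V.ae_supNorm_lt_top] with t ht using V.norm_le_speed ht

theorem intervalIntegrable_speed (a b : ℝ) : IntervalIntegrable V.speed volume a b :=
  V.integrable_speed.intervalIntegrable

end FieldSpace

theorem abs_intervalIntegral_le_integral {g : ℝ → ℝ} (hg : Integrable g) (h0 : ∀ t, 0 ≤ g t)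
    (a b : ℝ) : |∫ q in a..b, g q| ≤ ∫ q, g q := by
  rw [intervalIntegral.abs_integral_eq_abs_integral_uIoc, abs_of_nonneg (integral_nonneg h0)]
  exact setIntegral_le_integral hg (Eventually.of_forall h0)

namespace FieldSpace

variable (V : FieldSpace d T)

theorem abs_integral_speed_le (a b : ℝ) : |∫ q in a..b, V.speed q| ≤ ‖V‖ := by
  rw [← V.integral_speed]
  exact abs_intervalIntegral_le_integral V.integrable_speed V.speed_nonneg a b

theorem measurable_along {γ : ℝ → Rd d} (hγ : Measurable γ) : Measurable fun r => V r (γ r) :=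
  V.property.1.comp (measurable_id.prodMk hγ)

theorem integrable_along {γ : ℝ → Rd d} (hγ : Measurable γ) : Integrable fun r => V r (γ r) :=
  V.integrable_speed.mono' (V.measurable_along hγ).aestronglyMeasurable (by
    filter_upwards [V.ae_norm_le_speed] with t ht using ht _)

theorem norm_integral_along_le (γ : ℝ → Rd d) (a b : ℝ) :
    ‖∫ r in a..b, V r (γ r)‖ ≤ |∫ r in a..b, V.speed r| :=
  intervalIntegral.norm_integral_le_abs_of_norm_le
    (ae_restrict_of_ae (by filter_upwards [V.ae_norm_le_speed] with t ht using ht _))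
    (V.intervalIntegrable_speed a b)

end FieldSpace

/-- The nearest point of `[0,T]`. -/
def clamp (T s : ℝ) : ℝ := max 0 (min s T)

theorem continuous_clamp : Continuous (clamp T) := by
  unfold clamp
  fun_prop

theorem clamp_mem (hT : 0 ≤ T) (s : ℝ) : clamp T s ∈ Icc 0 T :=
  ⟨le_max_left _ _, max_le hT (min_le_right _ _)⟩

theorem clamp_of_mem {s : ℝ} (hs : s ∈ Icc 0 T) : clamp T s = s := by
  rw [clamp, min_eq_left hs.2, max_eq_right hs.1]

/-- A solution is arbitrary outside [0,T]. Freezing it at its end values makes it continuous on the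
whole line, so that `r ↦ V r (γ (clamp T r))` is measurable and integrable. -/
theorem IsODESolution.continuous_clamp {V : FieldSpace d T} {γ : ℝ → Rd d} (hT : 0 ≤ T)
    (h : IsODESolution T V γ) : Continuous fun s => γ (clamp T s) := by
  have hc := h.1.continuousOn
  rw [uIcc_of_le hT] at hc
  exact hc.comp_continuous GenericFlow.continuous_clamp (clamp_mem hT)

theorem IsODESolution.sub_eq_integral {V : FieldSpace d T} {γ : ℝ → Rd d} (hT : 0 ≤ T)
    (h : IsODESolution T V γ) {a b : ℝ} (ha : a ∈ Icc 0 T) (hb : b ∈ Icc 0 T) :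
    γ b - γ a = ∫ r in a..b, V r (γ (clamp T r)) := by
  rw [← uIcc_of_le hT] at ha hb
  refine AbsolutelyContinuousOnInterval.sub_eq_integral h.1
    (V.integrable_along (h.continuous_clamp hT).measurable).intervalIntegrable ?_ ha hb
  filter_upwards [ae_uIcc_of_ae_Ioo hT h.2] with t h1 h2
  rw [clamp_of_mem (by rwa [← uIcc_of_le hT])]
  exact h1 h2

theorem isODESolution_of_sub_eq_integral {V : FieldSpace d T} {γ : ℝ → Rd d} (hT : 0 ≤ T)
    (hγ : Continuous γ)
    (h : ∀ s ∈ Icc 0 T, γ s - γ 0 = ∫ r in (0 : ℝ)..s, V r (γ r)) : IsODESolution T V γ := by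
  have hi := V.integrable_along hγ.measurable
  refine ⟨?_, ae_hasDerivAt_of_sub_eq_integral hT hi.intervalIntegrable h⟩
  refine absolutelyContinuousOnInterval_of_dist_le (V.intervalIntegrable_speed 0 T)
    fun r hr s hs => ?_
  rw [uIcc_of_le hT] at hr hs
  have h3 : γ s - γ r = ∫ q in r..s, V q (γ q) := by
    rw [← intervalIntegral.integral_interval_sub_left hi.intervalIntegrable hi.intervalIntegrable
      (a := 0), ← h s hs, ← h r hr, sub_sub_sub_cancel_right]
  rw [dist_comm, dist_eq_norm, h3]
  exact V.norm_integral_along_le γ r s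

end

/-! ### Smooth fields and the density of well approximated fields -/

section

variable {d : ℕ} {T : ℝ}

/-- A time-dependent vector field `W(t,x) = ∑ ψ_i(x) f_i(t)` with finitely many terms, where the
`f_i` are bounded and measurable and the `ψ_i` are smooth with bounds on their derivatives. -/
structure SmoothField (d : ℕ) where
  /-- The index type of the sum. -/
  ι : Type
  [fintype : Fintype ι]
  /-- The time-dependent coefficients. -/
  f : ι → ℝ → Rd d
  /-- The space-dependent weights. -/
  ψ : ι → Rd d → ℝ
  /-- A bound of the coefficients. -/
  B : ℝ
  /-- A bound of the differentials of the weights. -/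
  L : ℝ
  /-- A Lipschitz constant of the differentials of the weights. -/
  Q : ℝ
  B_nonneg : 0 ≤ B
  L_nonneg : 0 ≤ L
  Q_nonneg : 0 ≤ Q
  measurable_f : ∀ i, Measurable (f i)
  norm_f_le : ∀ i t, ‖f i t‖ ≤ B
  contDiff_ψ : ∀ i, ContDiff ℝ ∞ (ψ i)
  abs_ψ_le : ∀ i x, |ψ i x| ≤ 1
  norm_fderiv_ψ_le : ∀ i x, ‖fderiv ℝ (ψ i) x‖ ≤ L
  norm_fderiv_ψ_sub_le : ∀ i x y, ‖fderiv ℝ (ψ i) x - fderiv ℝ (ψ i) y‖ ≤ Q * ‖x - y‖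

namespace SmoothField

attribute [instance] SmoothField.fintype

/-- The vector field itself. -/
def eval (W : SmoothField d) (t : ℝ) (x : Rd d) : Rd d := ∑ i, W.ψ i x • W.f i t

/-- The sum of the bounds of the coefficients. -/
def bound (W : SmoothField d) : ℝ := Fintype.card W.ι * W.B

/-- A Lipschitz constant in the space variable. -/
def lip (W : SmoothField d) : ℝ := W.bound * W.L

variable (W : SmoothField d)

theorem bound_nonneg : 0 ≤ W.bound := mul_nonneg (Nat.cast_nonneg _) W.B_nonneg

theorem lip_nonneg : 0 ≤ W.lip := mul_nonneg W.bound_nonneg W.L_nonneg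

theorem abs_ψ_sub_le (i : W.ι) (x y : Rd d) : |W.ψ i x - W.ψ i y| ≤ W.L * ‖x - y‖ :=
  convex_univ.norm_image_sub_le_of_norm_fderiv_le
    (fun z _ => ((W.contDiff_ψ i).differentiable (by simp)) z)
    (fun z _ => W.norm_fderiv_ψ_le i z) (mem_univ y) (mem_univ x)

theorem norm_eval_le (t : ℝ) (x : Rd d) : ‖W.eval t x‖ ≤ W.bound := by
  refine (norm_sum_le_of_le (n := fun _ => W.B) _ fun i _ => ?_).trans_eq ?_
  · rw [norm_smul]
    calc ‖W.ψ i x‖ * ‖W.f i t‖ ≤ 1 * W.B :=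
          mul_le_mul (W.abs_ψ_le i x) (W.norm_f_le i t) (norm_nonneg _) zero_le_one
      _ = W.B := one_mul _
  · simp [bound]

theorem norm_eval_sub_le (t : ℝ) (x y : Rd d) :
    ‖W.eval t x - W.eval t y‖ ≤ W.lip * ‖x - y‖ := by
  unfold eval
  rw [← Finset.sum_sub_distrib]
  refine (norm_sum_le_of_le (n := fun _ => W.L * ‖x - y‖ * W.B) _ fun i _ => ?_).trans_eq ?_
  · rw [← sub_smul, norm_smul]
    exact mul_le_mul (W.abs_ψ_sub_le i x y) (W.norm_f_le i t) (norm_nonneg _)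
      (mul_nonneg W.L_nonneg (norm_nonneg _))
  · simp [bound, lip]
    ring

theorem measurable_uncurry_eval : Measurable (Function.uncurry W.eval) := by
  refine Finset.measurable_fun_sum _ fun i _ => ?_
  exact ((W.contDiff_ψ i).continuous.measurable.comp measurable_snd).smul
    ((W.measurable_f i).comp measurable_fst)

theorem continuous_eval (t : ℝ) : Continuous (W.eval t) :=
  continuous_finsetSum _ fun i _ => (W.contDiff_ψ i).continuous.smul continuous_const

end SmoothField

/-- `U` coincides with the smooth field `W` on the ball of radius `n`, and `W` has an
integrable bound which is controlled by the norm of `U`. -/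
def IsApproximant (n : ℕ) (W : SmoothField d) (U : FieldSpace d T) : Prop :=
  (∀ t x, ‖x‖ ≤ n → U t x = W.eval t x) ∧
    ∃ b : ℝ → ℝ, Integrable b ∧ (∀ t x, ‖W.eval t x‖ ≤ b t) ∧ ∫ t, b t ≤ ‖U‖ + 1

/-- The fields which are very close to a field that is smooth on the ball of radius `n`. -/
def approxSet (d : ℕ) (T : ℝ) (n : ℕ) : Set (FieldSpace d T) :=
  ⋃ (W : SmoothField d) (U : FieldSpace d T) (_ : IsApproximant n W U),
    Metric.ball U (Real.exp (-(2 * W.lip * T)) / (n + 1))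

theorem isOpen_approxSet (n : ℕ) : IsOpen (approxSet d T n) :=
  isOpen_iUnion fun _ => isOpen_iUnion fun _ => isOpen_iUnion fun _ => Metric.isOpen_ball

/-- Finite smooth partitions of unity with small supports. -/
theorem exists_smooth_partition (R : ℝ) {δ : ℝ} (hδ : 0 < δ) :
    ∃ (s : Finset (Rd d)) (ψ : s → Rd d → ℝ), (∀ i, ContDiff ℝ ∞ (ψ i)) ∧
      (∀ i, HasCompactSupport (ψ i)) ∧ (∀ i x, 0 ≤ ψ i x) ∧ (∀ x, ∑ i, ψ i x ≤ 1) ∧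
      (∀ x, ‖x‖ ≤ R → ∑ i, ψ i x = 1) ∧ ∀ i x, ψ i x ≠ 0 → dist (i : Rd d) x < δ := by
  obtain ⟨s, -, hs⟩ := (isCompact_closedBall (0 : Rd d) R).elim_finite_subcover_image
    (b := univ) (c := fun x => Metric.ball x δ) (fun _ _ => Metric.isOpen_ball)
    (fun x _ => mem_iUnion₂.2 ⟨x, mem_univ _, Metric.mem_ball_self hδ⟩)
  obtain ⟨hfin, hs⟩ := hs
  lift s to Finset (Rd d) using hfin
  obtain ⟨f, hf⟩ := SmoothPartitionOfUnity.exists_isSubordinate (modelWithCornersSelf ℝ (Rd d))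
    (Metric.isClosed_closedBall (x := (0 : Rd d)) (ε := R))
    (fun i : s => Metric.ball (i : Rd d) δ) (fun _ => Metric.isOpen_ball)
    (fun x hx => by
      obtain ⟨i, hi, hx⟩ := mem_iUnion₂.1 (hs hx)
      exact mem_iUnion.2 ⟨⟨i, hi⟩, hx⟩)
  refine ⟨s, fun i => f i, fun i => (f i).contMDiff.contDiff, fun i => ?_, fun i x => f.nonneg i x,
    fun x => ?_, fun x hx => ?_, fun i x hx => ?_⟩
  · exact (isCompact_closedBall (i : Rd d) δ).of_isClosed_subset (isClosed_tsupport _)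
      ((hf i).trans Metric.ball_subset_closedBall)
  · rw [← finsum_eq_sum_of_fintype]
    exact f.sum_le_one x
  · rw [← finsum_eq_sum_of_fintype]
    exact f.sum_eq_one (by simpa using hx)
  · rw [dist_comm]
    exact hf i (subset_tsupport _ hx)

theorem exists_bounds_of_hasCompactSupport {ψ : Rd d → ℝ} (h : ContDiff ℝ ∞ ψ)
    (hc : HasCompactSupport ψ) : ∃ C : ℝ, 0 ≤ C ∧ (∀ x, ‖fderiv ℝ ψ x‖ ≤ C) ∧
      ∀ x y, ‖fderiv ℝ ψ x - fderiv ℝ ψ y‖ ≤ C * ‖x - y‖ := by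
  have h1 : ContDiff ℝ ∞ (fderiv ℝ ψ) := h.fderiv_right (by simp)
  obtain ⟨C, hC⟩ := h1.continuous.bounded_above_of_compact_support (hc.fderiv ℝ)
  obtain ⟨K, hK⟩ := ContDiff.lipschitzWith_of_hasCompactSupport (hc.fderiv ℝ) h1 (by simp)
  refine ⟨max C K, le_max_of_le_right K.2, fun x => (hC x).trans (le_max_left _ _), fun x y => ?_⟩
  refine (hK.norm_sub_le x y).trans ?_
  gcongr
  exact le_max_right _ _

/-- The smooth field obtained from a field by sampling with a partition of unity, at the times
where the field is bounded by `N`. -/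
theorem exists_sampling (V : FieldSpace d T) (R : ℝ) {δ : ℝ} (hδ : 0 < δ) (N : ℕ) :
    ∃ W : SmoothField d, (∀ t x, ‖W.eval t x‖ ≤ V.speed t) ∧
      (∀ t x, ‖W.eval t x‖ₑ ≤ supNorm (V t)) ∧
      ∀ t, supNorm (V t) ≤ N → ∀ x, ‖x‖ ≤ R → ∀ η : ℝ, (∀ y, dist y x < δ → ‖V t y - V t x‖ ≤ η) →
        ‖W.eval t x - V t x‖ ≤ η := by
  obtain ⟨s, ψ, h1, h2, h3, h4, h5, h6⟩ := exists_smooth_partition (d := d) R hδ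
  choose C hC0 hC1 hC2 using fun i => exists_bounds_of_hasCompactSupport (h1 i) (h2 i)
  have hCs : ∀ i, C i ≤ ∑ j, C j := fun i =>
    Finset.single_le_sum (fun j _ => hC0 j) (Finset.mem_univ i)
  have hm : MeasurableSet {t | supNorm (V t) ≤ N} :=
    measurableSet_le V.measurable_supNorm measurable_const
  have hlt : ∀ {t}, supNorm (V t) ≤ N → supNorm (V t) < ⊤ := fun h =>
    h.trans_lt (ENNReal.natCast_lt_top N)
  let W : SmoothField d :=
    { ι := s
      f := fun i => {t | supNorm (V t) ≤ N}.indicator fun t => V t i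
      ψ := ψ
      B := N
      L := ∑ j, C j
      Q := ∑ j, C j
      B_nonneg := Nat.cast_nonneg _
      L_nonneg := Finset.sum_nonneg fun j _ => hC0 j
      Q_nonneg := Finset.sum_nonneg fun j _ => hC0 j
      measurable_f := fun i => (V.measurable_along measurable_const).indicator hm
      norm_f_le := fun i t => by
        by_cases ht : t ∈ {t | supNorm (V t) ≤ N}
        · rw [indicator_of_mem ht]
          refine (V.norm_le_speed (hlt ht) i).trans ?_
          exact ENNReal.toReal_le_of_le_ofReal (Nat.cast_nonneg _) (by simpa using ht)
        · rw [indicator_of_notMem ht, norm_zero]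
          exact Nat.cast_nonneg _
      contDiff_ψ := h1
      abs_ψ_le := fun i x => by
        rw [abs_of_nonneg (h3 i x)]
        exact (Finset.single_le_sum (fun j _ => h3 j x) (Finset.mem_univ i)).trans (h4 x)
      norm_fderiv_ψ_le := fun i x => (hC1 i x).trans (hCs i)
      norm_fderiv_ψ_sub_le := fun i x y => (hC2 i x y).trans
        (mul_le_mul_of_nonneg_right (hCs i) (norm_nonneg _)) }
  have hW : ∀ t, supNorm (V t) ≤ N → ∀ x, W.eval t x = ∑ i, ψ i x • V t i := fun t ht x =>
    Finset.sum_congr rfl fun i _ => congrArg (ψ i x • ·)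
      (indicator_of_mem (s := {t | supNorm (V t) ≤ N}) ht fun t => V t i)
  have hW0 : ∀ t, ¬ supNorm (V t) ≤ N → ∀ x, W.eval t x = 0 := fun t ht x =>
    Finset.sum_eq_zero fun i _ => by
      change ψ i x • indicator {t | supNorm (V t) ≤ N} (fun t => V t i) t = 0
      rw [indicator_of_notMem (by exact ht), smul_zero]
  have hle : ∀ t x, ‖W.eval t x‖ ≤ V.speed t := fun t x => by
    by_cases ht : supNorm (V t) ≤ N
    · rw [hW t ht]
      calc ‖∑ i, ψ i x • V t i‖ ≤ ∑ i, ψ i x * V.speed t := norm_sum_le_of_le _ fun i _ => by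
            rw [norm_smul, Real.norm_of_nonneg (h3 i x)]
            exact mul_le_mul_of_nonneg_left (V.norm_le_speed (hlt ht) i) (h3 i x)
        _ = (∑ i, ψ i x) * V.speed t := by rw [Finset.sum_mul]
        _ ≤ V.speed t := mul_le_of_le_one_left (V.speed_nonneg t) (h4 x)
    · rw [hW0 t ht, norm_zero]
      exact V.speed_nonneg t
  refine ⟨W, hle, fun t x => ?_, fun t ht x hx η hη => ?_⟩
  · rw [← ofReal_norm]
    exact (ENNReal.ofReal_le_ofReal (hle t x)).trans ENNReal.ofReal_toReal_le
  · have : W.eval t x - V t x = ∑ i, ψ i x • (V t i - V t x) := by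
      simp_rw [smul_sub, Finset.sum_sub_distrib]
      rw [hW t ht, ← Finset.sum_smul, h5 x hx, one_smul]
    rw [this]
    calc ‖∑ i, ψ i x • (V t i - V t x)‖ ≤ ∑ i, ψ i x * η := norm_sum_le_of_le _ fun i _ => by
          rw [norm_smul, Real.norm_of_nonneg (h3 i x)]
          rcases eq_or_ne (ψ i x) 0 with h | h
          · rw [h, zero_mul, zero_mul]
          · exact mul_le_mul_of_nonneg_left (hη _ (h6 i x h)) (h3 i x)
      _ = η := by rw [← Finset.sum_mul, h5 x hx, one_mul]

/-- Gluing a field with a smooth field, by means of a cut-off function. -/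
theorem glue_mem_fields (V : FieldSpace d T) (W : SmoothField d) {χ : Rd d → ℝ} (hχ : Continuous χ)
    (h0 : ∀ x, 0 ≤ χ x) (h1 : ∀ x, χ x ≤ 1) (hW : ∀ t x, ‖W.eval t x‖ₑ ≤ supNorm (V t)) :
    (fun t x => V t x + χ x • (W.eval t x - V t x)) ∈ fields d T := by
  -- At each point the glued field is a convex combination of `V` and `W`, so its sup norm is at
  -- most that of `V t`. This gives both the integrability and the vanishing outside ]0,T[.
  have hle : ∀ t, supNorm (fun x => V t x + χ x • (W.eval t x - V t x)) ≤ supNorm (V t) := by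
    refine fun t => iSup_le fun x => ?_
    have h : V t x + χ x • (W.eval t x - V t x) = (1 - χ x) • V t x + χ x • W.eval t x := by
      module
    beta_reduce
    rw [h]
    calc ‖(1 - χ x) • V t x + χ x • W.eval t x‖ₑ
        ≤ ‖1 - χ x‖ₑ * supNorm (V t) + ‖χ x‖ₑ * supNorm (V t) := by
          refine (enorm_add_le _ _).trans ?_
          rw [enorm_smul, enorm_smul]
          gcongr
          · exact enorm_le_supNorm _ x
          · exact hW t x
      _ = supNorm (V t) := by
          rw [← add_mul, Real.enorm_of_nonneg (h0 x), Real.enorm_of_nonneg (sub_nonneg.2 (h1 x)),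
            ← ENNReal.ofReal_add (sub_nonneg.2 (h1 x)) (h0 x), sub_add_cancel, ENNReal.ofReal_one,
            one_mul]
  refine ⟨?_, fun t => ?_, fun t ht => ?_, ?_⟩
  · exact V.property.1.add ((hχ.measurable.comp measurable_snd).smul
      (W.measurable_uncurry_eval.sub V.property.1))
  · exact (V.continuous_apply t).add (hχ.smul ((W.continuous_eval t).sub (V.continuous_apply t)))
  · have h := hle t
    rw [V.eq_zero_of_notMem ht, supNorm_zero, nonpos_iff_eq_zero] at h
    ext1 x
    have h2 := enorm_le_supNorm (fun x => V t x + χ x • (W.eval t x - V t x)) x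
    rw [V.eq_zero_of_notMem ht] at h2
    rw [h, nonpos_iff_eq_zero, enorm_eq_zero] at h2
    change V t x + χ x • (W.eval t x - V t x) = 0
    rw [V.eq_zero_of_notMem ht]
    exact h2
  · exact (lintegral_mono hle).trans_lt (FieldSpace.cNorm_ne_top V).lt_top

/-- Sampling at scale 1/(N+1), at the times where `V t` is bounded by N, gives `W N`; a cut-off
keeps it on a large ball and returns to `V` far away. For almost every t, uniform continuity of `V
t` on a compact ball yields convergence in sup norm, and 2‖V_t‖_∞ dominates. The Lipschitz constants
of `W N` may blow up: this is harmless, as each `U N` is the centre of its own ball. -/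
theorem dense_approxSet (n : ℕ) : Dense (approxSet d T n) := by
  intro V
  -- The inner radius is n + 1 rather than n because it must be positive even for n = 0.
  let χ : ContDiffBump (0 : Rd d) := ⟨n + 1, n + 2, by positivity, by linarith⟩
  choose W hW1 hW2 hW3 using fun N : ℕ =>
    exists_sampling V (n + 2) (δ := 1 / ((N : ℝ) + 1)) (by positivity) N
  let U : ℕ → FieldSpace d T := fun N => FieldSpace.ofMem _
    (glue_mem_fields V (W N) χ.continuous (fun x => χ.nonneg) (fun x => χ.le_one) (hW2 N))
  have hU : ∀ N t x, U N t x = V t x + χ x • ((W N).eval t x - V t x) := fun N t x => rfl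
  have hUV : ∀ N t x, U N t x - V t x = χ x • ((W N).eval t x - V t x) := fun N t x => by
    rw [hU, add_sub_cancel_left]
  have hlim : Tendsto U atTop (𝓝 V) := by
    have h0 : Tendsto (fun N => ∫⁻ t in Ioo 0 T, supNorm (U N t - V t)) atTop
        (𝓝 (∫⁻ t in Ioo 0 T, 0)) := by
      refine tendsto_lintegral_of_dominated_convergence
        (fun t => supNorm (V t) + supNorm (V t)) (fun N => (U N - V).measurable_supNorm)
        (fun N => Eventually.of_forall fun t => iSup_le fun x => ?_) ?_ ?_
      · rw [Pi.sub_apply, hUV, enorm_smul]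
        calc ‖χ x‖ₑ * ‖(W N).eval t x - V t x‖ₑ ≤ 1 * (supNorm (V t) + supNorm (V t)) := by
              gcongr
              · rw [Real.enorm_of_nonneg χ.nonneg, ← ENNReal.ofReal_one]
                exact ENNReal.ofReal_le_ofReal χ.le_one
              · exact enorm_sub_le.trans (add_le_add (hW2 N t x) (enorm_le_supNorm _ x))
          _ = _ := one_mul _
      · rw [lintegral_add_left V.measurable_supNorm]
        exact ENNReal.add_ne_top.2 ⟨V.cNorm_ne_top, V.cNorm_ne_top⟩
      · filter_upwards [ae_restrict_of_ae V.ae_supNorm_lt_top] with t ht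
        rw [ENNReal.tendsto_nhds_zero]
        intro ε hε
        obtain ⟨η, hη, hηε⟩ : ∃ η : ℝ, 0 < η ∧ ENNReal.ofReal η ≤ ε := by
          rcases eq_or_ne ε ⊤ with rfl | h
          · exact ⟨1, one_pos, le_top⟩
          · exact ⟨ε.toReal, ENNReal.toReal_pos hε.ne' h, ENNReal.ofReal_toReal_le⟩
        have huc := (isCompact_closedBall (0 : Rd d) (n + 3)).uniformContinuousOn_of_continuous
          (V.continuous_apply t).continuousOn
        rw [Metric.uniformContinuousOn_iff_le] at huc
        obtain ⟨δ, hδ, H⟩ := huc η hη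
        -- The bound 1 keeps sampling points near the ball of radius n + 2 inside the ball of radius
        -- n + 3, where `V t` is uniformly continuous.
        obtain ⟨N₁, hN₁⟩ := exists_nat_one_div_lt (lt_min hδ one_pos)
        obtain ⟨N₂, hN₂⟩ := ENNReal.exists_nat_gt ht.ne
        filter_upwards [eventually_ge_atTop N₁, eventually_ge_atTop N₂] with N h1 h2
        refine iSup_le fun x => le_trans ?_ hηε
        rw [Pi.sub_apply, hUV, ← ofReal_norm, norm_smul, Real.norm_of_nonneg χ.nonneg]
        refine ENNReal.ofReal_le_ofReal ?_
        rcases le_or_gt ‖x‖ (n + 2) with hx | hx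
        · refine (mul_le_of_le_one_left (norm_nonneg _) χ.le_one).trans ?_
          refine hW3 N t (hN₂.le.trans (by exact_mod_cast h2)) x hx η fun y hy => ?_
          have h3 : dist y x < min δ 1 := hy.trans (lt_of_le_of_lt
            (one_div_le_one_div_of_le (by positivity) (by gcongr)) hN₁)
          have h4 := h3.trans_le (min_le_right _ _)
          rw [dist_eq_norm] at h4
          rw [← dist_eq_norm]
          refine H y ?_ x ?_ (h3.trans_le (min_le_left _ _)).le
          · rw [mem_closedBall_zero_iff]
            linarith [norm_le_norm_add_norm_sub' y x]
          · rw [mem_closedBall_zero_iff]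
            linarith
        · rw [χ.zero_of_le_dist (by simpa using! hx.le), zero_mul]
          exact hη.le
    rw [lintegral_zero] at h0
    rw [tendsto_iff_edist_tendsto_0]
    refine h0.congr fun N => ?_
    rw [edist_dist, dist_eq_norm, FieldSpace.ofReal_norm]
    rfl
  refine mem_closure_of_tendsto hlim ?_
  filter_upwards [hlim.eventually (Metric.ball_mem_nhds V one_pos)] with N hN
  -- The integrable bound is the speed of `V`, whose integral ‖V‖ is at most ‖U N‖ + 1 once `U N` is
  -- within distance 1 of `V`.
  refine mem_iUnion₂.2 ⟨W N, U N, mem_iUnion.2 ⟨⟨fun t x hx => ?_, V.speed, V.integrable_speed,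
    hW1 N, ?_⟩, Metric.mem_ball_self (by positivity)⟩⟩
  · rw [hU, χ.one_of_mem_closedBall (by
      rw [mem_closedBall_zero_iff]
      exact hx.trans (by simp [χ])), one_smul, add_sub_cancel]
  · rw [V.integral_speed]
    rw [dist_comm, dist_eq_norm] at hN
    linarith [norm_le_norm_add_norm_sub' V (U N)]

end

/-! ### Gronwall stability and construction of approximate solutions -/

section

variable {d : ℕ} {T : ℝ}

theorem integral_mul_exp_of_le {K t s : ℝ} (hts : t ≤ s) :
    ∫ r in t..s, K * Real.exp (2 * K * |r - t|) = (Real.exp (2 * K * |s - t|) - 1) / 2 := by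
  have h : ∀ r ∈ uIcc t s, HasDerivAt (fun r => Real.exp (2 * K * (r - t)) / 2)
      (K * Real.exp (2 * K * (r - t))) r := fun r _ => by
    have h := (((hasDerivAt_id r).sub_const t).const_mul (2 * K)).exp.div_const 2
    convert! h using 1
    simp only [id]
    ring
  rw [intervalIntegral.integral_congr (g := fun r => K * Real.exp (2 * K * (r - t))),
    intervalIntegral.integral_eq_sub_of_hasDerivAt h (Continuous.intervalIntegrable
      (by fun_prop) _ _), abs_of_nonneg (sub_nonneg.2 hts)]
  · simp
    ring
  · intro r hr
    rw [uIcc_of_le hts] at hr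
    simp only [abs_of_nonneg (sub_nonneg.2 hr.1)]

/-- With the weight exp(2K|r - t|), integrating K times a function from t becomes a contraction of
ratio 1/2. Gronwall's inequality and the Picard iteration below both rest on this. Times before t
reduce to times after t by the reflection r ↦ -r. -/
theorem abs_integral_mul_exp_le {K : ℝ} (hK : 0 ≤ K) (t s : ℝ) :
    |∫ r in t..s, K * Real.exp (2 * K * |r - t|)| ≤ Real.exp (2 * K * |s - t|) / 2 := by
  have key : ∀ u v : ℝ, u ≤ v →
      |∫ r in u..v, K * Real.exp (2 * K * |r - u|)| ≤ Real.exp (2 * K * |v - u|) / 2 := by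
    intro u v huv
    rw [integral_mul_exp_of_le huv, abs_of_nonneg]
    · linarith
    · have : 1 ≤ Real.exp (2 * K * |v - u|) := Real.one_le_exp (by positivity)
      linarith
  rcases le_total t s with h | h
  · exact key t s h
  · have h1 := key (-t) (-s) (neg_le_neg h)
    rw [← intervalIntegral.integral_comp_neg (a := s) (b := t)
      (f := fun r => K * Real.exp (2 * K * |r - -t|)), intervalIntegral.integral_symm, abs_neg]
      at h1
    have h2 : ∀ r : ℝ, |-r - -t| = |r - t| := fun r => by
      rw [← abs_neg]
      congr 1
      ring
    simp only [h2] at h1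
    exact h1

/-- A two-sided Gronwall inequality on `[0,T]`. -/
theorem le_mul_exp_of_le_add_integral {g : ℝ → ℝ} (hg : Continuous g) {A K t : ℝ}
    (hK : 0 ≤ K) (hA : 0 ≤ A) (ht : t ∈ Icc 0 T) (h0 : ∀ s, 0 ≤ g s)
    (h : ∀ s ∈ Icc 0 T, g s ≤ A + K * |∫ r in t..s, g r|) {s : ℝ} (hs : s ∈ Icc 0 T) :
    g s ≤ 2 * A * Real.exp (2 * K * T) := by
  -- Gronwall by maximality: if M is the maximum of `g` divided by the weight, the hypothesis at `m`
  -- bounds M times the weight by A plus half of itself, whence M ≤ 2A since the weight is at least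
  -- 1.
  obtain ⟨m, hm, hmax⟩ := isCompact_Icc.exists_isMaxOn ⟨t, ht⟩
    (f := fun r => g r * Real.exp (-(2 * K * |r - t|))) (s := Icc 0 T) (by fun_prop)
  set M := g m * Real.exp (-(2 * K * |m - t|)) with hM
  have hM0 : 0 ≤ M := mul_nonneg (h0 m) (Real.exp_nonneg _)
  have hle : ∀ r ∈ Icc 0 T, g r ≤ M * Real.exp (2 * K * |r - t|) := fun r hr => by
    have h1 : g r * Real.exp (-(2 * K * |r - t|)) ≤ M := hmax hr
    rwa [Real.exp_neg, ← div_eq_mul_inv, div_le_iff₀ (Real.exp_pos _)] at h1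
  have hint : ∀ r ∈ Icc 0 T, K * |∫ q in t..r, g q| ≤ M * (Real.exp (2 * K * |r - t|) / 2) :=
    fun r hr => by
    rw [← abs_of_nonneg hK, ← abs_mul, ← intervalIntegral.integral_const_mul, abs_of_nonneg hK]
    calc |∫ q in t..r, K * g q| ≤ |∫ q in t..r, M * (K * Real.exp (2 * K * |q - t|))| := by
          have hi : Continuous fun q : ℝ => M * (K * Real.exp (2 * K * |q - t|)) := by fun_prop
          rw [← Real.norm_eq_abs (∫ q in t..r, K * g q)]
          refine intervalIntegral.norm_integral_le_abs_of_norm_le ?_ (hi.intervalIntegrable t r)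
          rw [ae_restrict_iff' measurableSet_uIoc]
          refine Eventually.of_forall fun q hq => ?_
          rw [Real.norm_of_nonneg (mul_nonneg hK (h0 q))]
          have hq' : q ∈ Icc 0 T := ordConnected_Icc.uIcc_subset ht hr (uIoc_subset_uIcc hq)
          calc K * g q ≤ K * (M * Real.exp (2 * K * |q - t|)) :=
                mul_le_mul_of_nonneg_left (hle q hq') hK
            _ = _ := by ring
      _ ≤ M * (Real.exp (2 * K * |r - t|) / 2) := by
          rw [intervalIntegral.integral_const_mul, abs_mul, abs_of_nonneg hM0]
          exact mul_le_mul_of_nonneg_left (abs_integral_mul_exp_le hK t r) hM0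
  have hMA : M ≤ 2 * A := by
    have h1 := (h m hm).trans (add_le_add_right (hint m hm) A)
    have h2 : g m = M * Real.exp (2 * K * |m - t|) := by
      rw [hM, mul_assoc, ← Real.exp_add, neg_add_cancel, Real.exp_zero, mul_one]
    have h3 : M / 2 * Real.exp (2 * K * |m - t|) ≤ A := by linarith
    have h4 : 1 ≤ Real.exp (2 * K * |m - t|) := Real.one_le_exp (by positivity)
    nlinarith
  calc g s ≤ M * Real.exp (2 * K * |s - t|) := hle s hs
    _ ≤ 2 * A * Real.exp (2 * K * T) := by
      have : |s - t| ≤ T := by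
        rw [abs_le]
        constructor <;> linarith [hs.1, hs.2, ht.1, ht.2]
      gcongr

/-- The properties of a smooth approximation of a field of `approxSet`. -/
theorem exists_approximation {V : FieldSpace d T} {n : ℕ} (hV : V ∈ approxSet d T n) :
    ∃ (W : SmoothField d) (e b : ℝ → ℝ), Integrable e ∧ (∀ t, 0 ≤ e t) ∧
      ∫ t, e t ≤ Real.exp (-(2 * W.lip * T)) / (n + 1) ∧
      (∀ᵐ t, ∀ x, ‖x‖ ≤ n → ‖V t x - W.eval t x‖ ≤ e t) ∧
      Integrable b ∧ (∀ t x, ‖W.eval t x‖ ≤ b t) ∧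
      ∫ t, b t ≤ ‖V‖ + 1 + Real.exp (-(2 * W.lip * T)) := by
  simp only [approxSet, mem_iUnion] at hV
  obtain ⟨W, U, ⟨hU, b, hb, hWb, hbU⟩, hVU⟩ := hV
  rw [mem_ball_iff_norm] at hVU
  refine ⟨W, (V - U).speed, b, (V - U).integrable_speed, (V - U).speed_nonneg, ?_, ?_, hb, hWb, ?_⟩
  · rw [FieldSpace.integral_speed]
    exact hVU.le
  · filter_upwards [(V - U).ae_norm_le_speed] with t ht x hx
    rw [← hU t x hx]
    exact ht x
  · have h1 : ‖U‖ ≤ ‖V‖ + ‖V - U‖ := norm_le_norm_add_norm_sub V U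
    have h2 : Real.exp (-(2 * W.lip * T)) / (n + 1) ≤ Real.exp (-(2 * W.lip * T)) :=
      div_le_self (Real.exp_nonneg _) (by linarith [Nat.cast_nonneg (α := ℝ) n])
    linarith

/-- `γ` solves the integral form of (ODE) on `[0,T]`, with value `x` at time `t`, up to an
error `η`. -/
def IsApproxSolution (V : FieldSpace d T) (t : ℝ) (x : Rd d) (η : ℝ) (γ : ℝ → Rd d) : Prop :=
  Continuous γ ∧ ∀ s ∈ Icc 0 T, ‖γ s - x - ∫ r in t..s, V r (γ r)‖ ≤ η

/-- The displacement due to the field is at most the integral of its speed, which is at most ‖V‖.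
This confinement is why an approximation of `V` on balls suffices. -/
theorem IsApproxSolution.norm_le {V : FieldSpace d T} {t : ℝ} {x : Rd d} {η : ℝ} {γ : ℝ → Rd d}
    (h : IsApproxSolution V t x η γ) {s : ℝ} (hs : s ∈ Icc 0 T) : ‖γ s‖ ≤ ‖x‖ + η + ‖V‖ := by
  have h1 := h.2 s hs
  have h2 := (V.norm_integral_along_le γ t s).trans (V.abs_integral_speed_le t s)
  have h3 : γ s = x + (γ s - x - ∫ r in t..s, V r (γ r)) + ∫ r in t..s, V r (γ r) := by abel
  rw [h3]
  refine (norm_add₃_le ..).trans ?_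
  linarith

/-- Approximate solutions which start from the same time and from nearby points stay close. -/
theorem exists_stability {V : FieldSpace d T} {n : ℕ} (hV : V ∈ approxSet d T n) :
    ∃ C : ℝ, 0 ≤ C ∧ ∀ t ∈ Icc 0 T, ∀ (x : Rd d) (η₁ η₂ : ℝ) (γ₁ γ₂ : ℝ → Rd d),
      IsApproxSolution V t x η₁ γ₁ → IsApproxSolution V t x η₂ γ₂ →
      ‖x‖ + η₁ + ‖V‖ ≤ n → ‖x‖ + η₂ + ‖V‖ ≤ n →
      ∀ s ∈ Icc 0 T, ‖γ₁ s - γ₂ s‖ ≤ C * (η₁ + η₂) + 4 / (n + 1) := by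
  obtain ⟨W, e, -, he, he0, hen, hVW, -⟩ := exists_approximation hV
  refine ⟨2 * Real.exp (2 * W.lip * T), by positivity, ?_⟩
  intro t ht x η₁ η₂ γ₁ γ₂ h₁ h₂ hn₁ hn₂ s hs
  have hc : Continuous fun s => ‖γ₁ s - γ₂ s‖ := (h₁.1.sub h₂.1).norm
  have hη₁ : 0 ≤ η₁ := (norm_nonneg _).trans (h₁.2 t ht)
  have hη₂ : 0 ≤ η₂ := (norm_nonneg _).trans (h₂.2 t ht)
  have hE : 0 ≤ ∫ t, e t := integral_nonneg he0
  -- Exchanging `V` for `W` along the two curves costs 2∫e; what remains is Lipschitz.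
  have main : ∀ s ∈ Icc 0 T, ‖γ₁ s - γ₂ s‖ ≤
      (η₁ + η₂ + 2 * ∫ t, e t) + W.lip * |∫ r in t..s, ‖γ₁ r - γ₂ r‖| := by
    intro s hs
    have hi₁ := (V.integrable_along h₁.1.measurable).intervalIntegrable (a := t) (b := s)
    have hi₂ := (V.integrable_along h₂.1.measurable).intervalIntegrable (a := t) (b := s)
    have hci : IntervalIntegrable (fun r => W.lip * ‖γ₁ r - γ₂ r‖) volume t s :=
      (hc.const_mul W.lip |>.intervalIntegrable t s)
    have h3 : γ₁ s - γ₂ s = (γ₁ s - x - ∫ r in t..s, V r (γ₁ r)) -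
        (γ₂ s - x - ∫ r in t..s, V r (γ₂ r)) + ∫ r in t..s, (V r (γ₁ r) - V r (γ₂ r)) := by
      rw [intervalIntegral.integral_sub hi₁ hi₂]
      abel
    have h4 : ‖∫ r in t..s, (V r (γ₁ r) - V r (γ₂ r))‖ ≤
        |∫ r in t..s, (2 * e r + W.lip * ‖γ₁ r - γ₂ r‖)| := by
      refine intervalIntegral.norm_integral_le_abs_of_norm_le ?_
        ((he.const_mul 2).intervalIntegrable.add hci)
      rw [ae_restrict_iff' measurableSet_uIoc]
      filter_upwards [hVW] with r hr hrs
      have hr' : r ∈ Icc 0 T := ordConnected_Icc.uIcc_subset ht hs (uIoc_subset_uIcc hrs)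
      have h5 := hr (γ₁ r) ((h₁.norm_le hr').trans hn₁)
      have h6 := hr (γ₂ r) ((h₂.norm_le hr').trans hn₂)
      have h7 := W.norm_eval_sub_le r (γ₁ r) (γ₂ r)
      have h8 : V r (γ₁ r) - V r (γ₂ r) = (V r (γ₁ r) - W.eval r (γ₁ r)) -
        (V r (γ₂ r) - W.eval r (γ₂ r)) + (W.eval r (γ₁ r) - W.eval r (γ₂ r)) := by abel
      rw [h8]
      refine (norm_add_le _ _).trans ?_
      have h9 := norm_sub_le (V r (γ₁ r) - W.eval r (γ₁ r)) (V r (γ₂ r) - W.eval r (γ₂ r))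
      linarith
    have h5 : |∫ r in t..s, (2 * e r + W.lip * ‖γ₁ r - γ₂ r‖)| ≤
        2 * (∫ t, e t) + W.lip * |∫ r in t..s, ‖γ₁ r - γ₂ r‖| := by
      rw [intervalIntegral.integral_add (he.const_mul 2).intervalIntegrable hci,
        intervalIntegral.integral_const_mul, intervalIntegral.integral_const_mul]
      refine (abs_add_le _ _).trans ?_
      rw [abs_mul, abs_mul, abs_two, abs_of_nonneg W.lip_nonneg]
      have := abs_intervalIntegral_le_integral he he0 t s
      linarith
    rw [h3]
    refine (norm_add_le _ _).trans ?_
    have h6 := norm_sub_le (γ₁ s - x - ∫ r in t..s, V r (γ₁ r))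
      (γ₂ s - x - ∫ r in t..s, V r (γ₂ r))
    linarith [h₁.2 s hs, h₂.2 s hs]
  have h := le_mul_exp_of_le_add_integral hc W.lip_nonneg (by positivity) ht
    (fun _ => norm_nonneg _) main hs
  refine h.trans ?_
  -- The radius of the balls in `approxSet` cancels the Gronwall factor. The final 4 is the factor 2
  -- of Gronwall times the two curves.
  have h1 : Real.exp (2 * W.lip * T) * ∫ t, e t ≤ 1 / (n + 1) := by
    calc Real.exp (2 * W.lip * T) * ∫ t, e t
        ≤ Real.exp (2 * W.lip * T) * (Real.exp (-(2 * W.lip * T)) / (n + 1)) := by gcongr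
      _ = 1 / (n + 1) := by rw [← mul_div_assoc, ← Real.exp_add, add_neg_cancel, Real.exp_zero]
  have h2 : (4 : ℝ) / (n + 1) = 4 * (1 / (n + 1)) := by ring
  rw [h2]
  nlinarith

namespace SmoothField

variable (W : SmoothField d)

theorem measurable_along {γ : ℝ → Rd d} (hγ : Measurable γ) :
    Measurable fun r => W.eval r (γ r) :=
  W.measurable_uncurry_eval.comp (measurable_id.prodMk hγ)

theorem intervalIntegrable_along {γ : ℝ → Rd d} (hγ : Measurable γ) (a b : ℝ) :
    IntervalIntegrable (fun r => W.eval r (γ r)) volume a b :=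
  (intervalIntegrable_const (c := W.bound)).mono_fun'
    (W.measurable_along hγ).aestronglyMeasurable
    (Eventually.of_forall fun r => W.norm_eval_le r _)

/-- Picard iteration. -/
def picard (t : ℝ) (x : Rd d) : ℕ → ℝ → Rd d
  | 0 => fun _ => x
  | j + 1 => fun s => x + ∫ r in t..s, W.eval r (picard t x j r)

theorem continuous_picard (t : ℝ) (x : Rd d) (j : ℕ) : Continuous (W.picard t x j) := by
  induction j with
  | zero => exact continuous_const
  | succ j ih =>
    exact continuous_const.add (intervalIntegral.continuous_primitive
      (fun a b => W.intervalIntegrable_along ih.measurable a b) t)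

/-- Each iteration halves the increment in the weighted norm. Only the smallness of one increment is
used later, since it bounds the defect of the corresponding iterate; convergence of the iteration is
not needed. -/
theorem norm_picard_sub_le (hT : 0 ≤ T) {t : ℝ} (ht : t ∈ Icc 0 T) (x : Rd d) (j : ℕ) {s : ℝ}
    (hs : s ∈ Icc 0 T) : ‖W.picard t x (j + 1) s - W.picard t x j s‖ ≤
      W.bound * T * (1 / 2) ^ j * Real.exp (2 * W.lip * |s - t|) := by
  have hB := W.bound_nonneg
  have hK := W.lip_nonneg
  induction j generalizing s with
  | zero =>
    have h1 : |s - t| ≤ T := by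
      rw [abs_le]
      constructor <;> linarith [hs.1, hs.2, ht.1, ht.2]
    have h2 : 1 ≤ Real.exp (2 * W.lip * |s - t|) := Real.one_le_exp (by positivity)
    have h3 : ‖∫ r in t..s, W.eval r x‖ ≤ W.bound * |s - t| :=
      intervalIntegral.norm_integral_le_of_norm_le_const fun r _ => W.norm_eval_le r _
    simp only [picard, add_sub_cancel_left, pow_zero, mul_one]
    calc _ ≤ W.bound * |s - t| := h3
      _ ≤ W.bound * T * 1 := by
        rw [mul_one]
        gcongr
      _ ≤ _ := by gcongr
  | succ j ih =>
    have h1 : W.picard t x (j + 1 + 1) s - W.picard t x (j + 1) s =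
        ∫ r in t..s, (W.eval r (W.picard t x (j + 1) r) - W.eval r (W.picard t x j r)) := by
      rw [intervalIntegral.integral_sub
        (W.intervalIntegrable_along (W.continuous_picard t x _).measurable _ _)
        (W.intervalIntegrable_along (W.continuous_picard t x _).measurable _ _)]
      exact add_sub_add_left_eq_sub _ _ _
    rw [h1]
    calc _ ≤ |∫ r in t..s, W.bound * T * (1 / 2) ^ j *
          (W.lip * Real.exp (2 * W.lip * |r - t|))| := by
          refine intervalIntegral.norm_integral_le_abs_of_norm_le ?_
            (Continuous.intervalIntegrable (by fun_prop) _ _)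
          rw [ae_restrict_iff' measurableSet_uIoc]
          refine Eventually.of_forall fun r hr => (W.norm_eval_sub_le _ _ _).trans ?_
          calc _ ≤ W.lip * (W.bound * T * (1 / 2) ^ j * Real.exp (2 * W.lip * |r - t|)) :=
                mul_le_mul_of_nonneg_left (ih
                  (ordConnected_Icc.uIcc_subset ht hs (uIoc_subset_uIcc hr))) hK
            _ = _ := by ring
      _ ≤ W.bound * T * (1 / 2) ^ j * (Real.exp (2 * W.lip * |s - t|) / 2) := by
          rw [intervalIntegral.integral_const_mul, abs_mul, abs_of_nonneg (by positivity)]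
          exact mul_le_mul_of_nonneg_left (abs_integral_mul_exp_le hK t s) (by positivity)
      _ = _ := by ring

end SmoothField

/-- A late Picard iterate for a good approximant `W` works. Its defect for `V` is the next Picard
increment plus the error of replacing `V` by `W`, each at most η/2. -/
theorem exists_isApproxSolution {V : FieldSpace d T} (hV : ∀ n, V ∈ approxSet d T n) (hT : 0 ≤ T)
    {t : ℝ} (ht : t ∈ Icc 0 T) (x : Rd d) {η : ℝ} (hη : 0 < η) :
    ∃ γ, IsApproxSolution V t x η γ := by
  obtain ⟨N, hN⟩ := exists_nat_one_div_lt (half_pos hη)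
  obtain ⟨M, hM⟩ := exists_nat_ge (‖x‖ + ‖V‖ + 2)
  set n := max N M
  obtain ⟨W, e, b, he, he0, hen, hVW, hb, hWb, hbV⟩ := exists_approximation (hV n)
  have hB := W.bound_nonneg
  have hK := W.lip_nonneg
  have hexp : Real.exp (-(2 * W.lip * T)) ≤ 1 := Real.exp_le_one_iff.2 (by
    have : 0 ≤ 2 * W.lip * T := by positivity
    linarith)
  have hnM : (M : ℝ) ≤ n := by exact_mod_cast le_max_right N M
  have hnN : (N : ℝ) ≤ n := by exact_mod_cast le_max_left N M
  have heη : ∫ t, e t ≤ η / 2 := by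
    refine hen.trans (le_trans ?_ hN.le)
    gcongr
  obtain ⟨j, hj⟩ : ∃ j : ℕ, W.bound * T * Real.exp (2 * W.lip * T) * (1 / 2) ^ j < η / 2 := by
    have h := (tendsto_pow_atTop_nhds_zero_of_lt_one (r := (1 / 2 : ℝ)) (by norm_num)
      (by norm_num)).const_mul (W.bound * T * Real.exp (2 * W.lip * T))
    rw [mul_zero] at h
    exact (h.eventually (gt_mem_nhds (half_pos hη))).exists
  have hb0 : ∀ t, 0 ≤ b t := fun t => (norm_nonneg _).trans (hWb t 0)
  -- The radius n was fixed before `W` was known, so `W.bound` cannot be used here. The bound `b`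
  -- can: its integral is at most ‖V‖ + 2 whatever `W` is.
  have hball : ∀ j s, ‖W.picard t x j s‖ ≤ n := by
    intro j s
    rcases j with _ | j
    · simp only [SmoothField.picard]
      linarith [norm_nonneg V]
    · have h1 : ‖∫ r in t..s, W.eval r (W.picard t x j r)‖ ≤ |∫ r in t..s, b r| :=
        intervalIntegral.norm_integral_le_abs_of_norm_le (Eventually.of_forall fun r => hWb r _)
          hb.intervalIntegrable
      have h2 := abs_intervalIntegral_le_integral hb hb0 t s
      refine (norm_add_le x (∫ r in t..s, W.eval r (W.picard t x j r))).trans ?_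
      linarith
  refine ⟨W.picard t x j, W.continuous_picard t x j, fun s hs => ?_⟩
  have hm := (W.continuous_picard t x j).measurable
  have h1 : W.picard t x j s - x - ∫ r in t..s, V r (W.picard t x j r) =
      -(W.picard t x (j + 1) s - W.picard t x j s) -
      ∫ r in t..s, (V r (W.picard t x j r) - W.eval r (W.picard t x j r)) := by
    rw [intervalIntegral.integral_sub (V.integrable_along hm).intervalIntegrable
      (W.intervalIntegrable_along hm _ _)]
    simp only [SmoothField.picard]
    abel
  have h2 := W.norm_picard_sub_le hT ht x j hs
  have h3 : ‖∫ r in t..s, (V r (W.picard t x j r) - W.eval r (W.picard t x j r))‖ ≤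
      |∫ r in t..s, e r| := by
    refine intervalIntegral.norm_integral_le_abs_of_norm_le (ae_restrict_of_ae ?_)
      he.intervalIntegrable
    filter_upwards [hVW] with r hr using hr _ (hball j r)
  have h4 := abs_intervalIntegral_le_integral he he0 t s
  have h5 : |s - t| ≤ T := by
    rw [abs_le]
    constructor <;> linarith [hs.1, hs.2, ht.1, ht.2]
  have h6 : W.bound * T * (1 / 2) ^ j * Real.exp (2 * W.lip * |s - t|) ≤
      W.bound * T * Real.exp (2 * W.lip * T) * (1 / 2) ^ j := by
    rw [mul_right_comm]
    gcongr
  rw [h1]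
  refine (norm_sub_le _ _).trans ?_
  rw [norm_neg]
  linarith

end

/-! ### Existence, uniqueness and continuity of the flow -/

section

variable {d : ℕ} {T : ℝ}

/-- The order of choices matters: n is taken first, to make 4/(n+1) small, which fixes the stability
constant `C`; the defect δ is then small relative to `C`. -/
theorem exists_stability_eps {V : FieldSpace d T} (hV : ∀ n, V ∈ approxSet d T n)
    (x : Rd d) {ε : ℝ} (hε : 0 < ε) :
    ∃ δ : ℝ, 0 < δ ∧ ∀ t ∈ Icc 0 T, ∀ (η₁ η₂ : ℝ) (γ₁ γ₂ : ℝ → Rd d),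
      IsApproxSolution V t x η₁ γ₁ → IsApproxSolution V t x η₂ γ₂ → η₁ ≤ δ → η₂ ≤ δ →
      ∀ s ∈ Icc 0 T, ‖γ₁ s - γ₂ s‖ ≤ ε := by
  obtain ⟨N, hN⟩ := exists_nat_one_div_lt (show 0 < ε / 8 by positivity)
  obtain ⟨M, hM⟩ := exists_nat_ge (‖x‖ + 1 + ‖V‖)
  have hnM : (M : ℝ) ≤ (max N M : ℕ) := by exact_mod_cast le_max_right N M
  have hnN : (N : ℝ) ≤ (max N M : ℕ) := by exact_mod_cast le_max_left N M
  obtain ⟨C, hC, H⟩ := exists_stability (hV (max N M))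
  -- The bound 1 keeps the curves in the ball of radius n; the other bound gives C(η₁+η₂) ≤ ε/2,
  -- with `C + 1` to avoid dividing by zero.
  refine ⟨min 1 (ε / (4 * (C + 1))), by positivity, ?_⟩
  intro t ht η₁ η₂ γ₁ γ₂ h₁ h₂ hη₁ hη₂ s hs
  have a₁ := hη₁.trans (min_le_left _ _)
  have a₂ := hη₂.trans (min_le_left _ _)
  have b₁ := hη₁.trans (min_le_right _ _)
  have b₂ := hη₂.trans (min_le_right _ _)
  refine (H t ht x η₁ η₂ γ₁ γ₂ h₁ h₂ (by linarith) (by linarith) s hs).trans ?_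
  have h3 : (4 : ℝ) / ((max N M : ℕ) + 1) ≤ ε / 2 := by
    have : (1 : ℝ) / ((max N M : ℕ) + 1) ≤ 1 / (N + 1) := by gcongr
    have h4 : (4 : ℝ) / ((max N M : ℕ) + 1) = 4 * (1 / ((max N M : ℕ) + 1)) := by ring
    linarith
  have h5 : C * (η₁ + η₂) ≤ ε / 2 := by
    calc C * (η₁ + η₂) ≤ (C + 1) * (2 * (ε / (4 * (C + 1)))) := by
          have h6 : 0 ≤ 2 * (ε / (4 * (C + 1))) := by positivity
          have h7 : η₁ + η₂ ≤ 2 * (ε / (4 * (C + 1))) := by linarith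
          calc C * (η₁ + η₂) ≤ C * (2 * (ε / (4 * (C + 1)))) := by gcongr
            _ ≤ _ := by
              gcongr
              linarith
      _ = ε / 2 := by
          field_simp
          ring
  linarith

/-- Approximate solutions with defect 1/(m+1) are uniformly Cauchy by stability. The limit passes
through the integral by dominated convergence, using continuity of each `V r` and the speed as
bound. -/
theorem exists_solution {V : FieldSpace d T} (hV : ∀ n, V ∈ approxSet d T n) (hT : 0 ≤ T)
    {t : ℝ} (ht : t ∈ Icc 0 T) (x : Rd d) : ∃ γ, IsApproxSolution V t x 0 γ := by
  choose γ hγ using fun m : ℕ =>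
    exists_isApproxSolution hV hT ht x (η := 1 / ((m : ℝ) + 1)) (by positivity)
  have hC : UniformCauchySeqOn (fun m s => γ m (clamp T s)) atTop univ := by
    rw [Metric.uniformCauchySeqOn_iff]
    intro ε hε
    obtain ⟨δ, hδ, H⟩ := exists_stability_eps hV x (half_pos hε)
    obtain ⟨N, hN⟩ := exists_nat_one_div_lt hδ
    have hle : ∀ m ≥ N, 1 / ((m : ℝ) + 1) ≤ δ := fun m hm =>
      (one_div_le_one_div_of_le (by positivity) (by gcongr)).trans hN.le
    refine ⟨N, fun m hm n hn s _ => ?_⟩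
    rw [dist_eq_norm]
    exact (H t ht _ _ _ _ (hγ m) (hγ n) (hle m hm) (hle n hn) _ (clamp_mem hT s)).trans_lt
      (half_lt_self hε)
  choose Γ hΓ using fun s => cauchySeq_tendsto_of_complete (hC.cauchySeq (mem_univ s))
  have hU : TendstoUniformly (fun m s => γ m (clamp T s)) Γ atTop :=
    tendstoUniformlyOn_univ.1 (hC.tendstoUniformlyOn_of_tendsto fun s _ => hΓ s)
  have hΓc : Continuous Γ := hU.continuous
    (Frequently.of_forall fun m => (hγ m).1.comp continuous_clamp)
  refine ⟨Γ, hΓc, fun s hs => ?_⟩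
  have hint : Tendsto (fun m => ∫ r in t..s, V r (γ m r)) atTop (𝓝 (∫ r in t..s, V r (Γ r))) := by
    refine intervalIntegral.tendsto_integral_filter_of_dominated_convergence V.speed
      (Eventually.of_forall fun m => (V.measurable_along (hγ m).1.measurable).aestronglyMeasurable)
      (Eventually.of_forall fun m => ?_) (V.intervalIntegrable_speed t s)
      (Eventually.of_forall fun r hr => ?_)
    · filter_upwards [V.ae_norm_le_speed] with r hr _ using hr _
    · have hr' : r ∈ Icc 0 T := ordConnected_Icc.uIcc_subset ht hs (uIoc_subset_uIcc hr)
      have h1 := hΓ r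
      rw [clamp_of_mem hr'] at h1
      exact ((V.continuous_apply r).tendsto _).comp h1
  have h1 := hΓ s
  rw [clamp_of_mem hs] at h1
  exact le_of_tendsto_of_tendsto ((h1.sub_const x).sub hint).norm
    tendsto_one_div_add_atTop_nhds_zero_nat (Eventually.of_forall fun m => (hγ m).2 s hs)

theorem eq_of_isApproxSolution_zero {V : FieldSpace d T} (hV : ∀ n, V ∈ approxSet d T n)
    {t : ℝ} (ht : t ∈ Icc 0 T) {x : Rd d} {γ₁ γ₂ : ℝ → Rd d}
    (h₁ : IsApproxSolution V t x 0 γ₁) (h₂ : IsApproxSolution V t x 0 γ₂) {s : ℝ}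
    (hs : s ∈ Icc 0 T) : γ₁ s = γ₂ s := by
  rw [← sub_eq_zero, ← norm_le_zero_iff]
  refine le_of_forall_pos_le_add fun ε hε => ?_
  obtain ⟨δ, hδ, H⟩ := exists_stability_eps hV x hε
  rw [zero_add]
  exact H t ht _ _ _ _ h₁ h₂ hδ.le hδ.le s hs

theorem IsODESolution.isApproxSolution {V : FieldSpace d T} (hT : 0 ≤ T) {γ : ℝ → Rd d}
    (h : IsODESolution T V γ) {t : ℝ} (ht : t ∈ Icc 0 T) :
    IsApproxSolution V t (γ t) 0 fun s => γ (clamp T s) := by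
  refine ⟨h.continuous_clamp hT, fun s hs => ?_⟩
  have h1 : γ (clamp T s) - γ t = ∫ r in t..s, V r (γ (clamp T r)) := by
    rw [clamp_of_mem hs, h.sub_eq_integral hT ht hs]
  exact (norm_eq_zero.2 (sub_eq_zero.2 h1)).le

namespace IsApproxSolution

variable {V : FieldSpace d T} {t : ℝ} {x : Rd d} {γ : ℝ → Rd d}

theorem eq_add_integral (h : IsApproxSolution V t x 0 γ) {s : ℝ} (hs : s ∈ Icc 0 T) :
    γ s = x + ∫ r in t..s, V r (γ r) := by
  have h1 := h.2 s hs
  rwa [norm_le_zero_iff, sub_sub, sub_eq_zero] at h1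

theorem apply_self (h : IsApproxSolution V t x 0 γ) (ht : t ∈ Icc 0 T) : γ t = x := by
  rw [h.eq_add_integral ht, intervalIntegral.integral_same, add_zero]

theorem sub_eq_integral (h : IsApproxSolution V t x 0 γ) {r s : ℝ} (hr : r ∈ Icc 0 T)
    (hs : s ∈ Icc 0 T) : γ s - γ r = ∫ q in r..s, V q (γ q) := by
  have hi := V.integrable_along h.1.measurable
  rw [h.eq_add_integral hr, h.eq_add_integral hs, add_sub_add_left_eq_sub,
    intervalIntegral.integral_interval_sub_left hi.intervalIntegrable hi.intervalIntegrable]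

theorem isODESolution (hT : 0 ≤ T) (h : IsApproxSolution V t x 0 γ) : IsODESolution T V γ :=
  isODESolution_of_sub_eq_integral hT h.1 fun _ hs =>
    h.sub_eq_integral (left_mem_Icc.2 hT) hs

theorem norm_sub_le_integral_speed (h : IsApproxSolution V t x 0 γ) {r s : ℝ} (hr : r ∈ Icc 0 T)
    (hs : s ∈ Icc 0 T) : ‖γ s - γ r‖ ≤ |∫ q in r..s, V.speed q| := by
  rw [h.sub_eq_integral hr hs]
  exact V.norm_integral_along_le γ r s

/-- A solution through `(t, x)` is an approximate solution through any nearby point. -/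
theorem change_base (h : IsApproxSolution V t x 0 γ) (t' : ℝ) (x' : Rd d) :
    IsApproxSolution V t' x' (‖x - x'‖ + |∫ q in t'..t, V.speed q|) γ := by
  refine ⟨h.1, fun s hs => ?_⟩
  have hi := V.integrable_along h.1.measurable
  have h1 : γ s - x' - ∫ r in t'..s, V r (γ r) = (x - x') - ∫ r in t'..t, V r (γ r) := by
    rw [h.eq_add_integral hs, ← intervalIntegral.integral_add_adjacent_intervals
      hi.intervalIntegrable hi.intervalIntegrable (a := t') (b := t) (c := s)]
    abel
  rw [h1]
  exact (norm_sub_le _ _).trans (add_le_add_right (V.norm_integral_along_le γ t' t) _)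

end IsApproxSolution

/-- The flow of a field in all the sets `approxSet d T n`. -/
def flow {V : FieldSpace d T} (hV : ∀ n, V ∈ approxSet d T n) (hT : 0 ≤ T) (t s : ℝ) (x : Rd d) :
    Rd d :=
  (exists_solution hV hT (clamp_mem hT t) x).choose s

variable {V : FieldSpace d T} (hV : ∀ n, V ∈ approxSet d T n) (hT : 0 ≤ T)

theorem isApproxSolution_flow {t : ℝ} (ht : t ∈ Icc 0 T) (x : Rd d) :
    IsApproxSolution V t x 0 fun s => flow hV hT t s x := by
  have h : IsApproxSolution V (clamp T t) x 0 fun s => flow hV hT t s x :=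
    (exists_solution hV hT (clamp_mem hT t) x).choose_spec
  rwa [clamp_of_mem ht] at h

/-- By `change_base`, the solution through (t,x) is an approximate solution through (t₀,x₀) with a
defect that tends to 0. Stability then gives closeness uniformly in s, and the modulus of continuity
in s is that of the primitive of the speed. Borel measurability of the flow, although it is defined
by choice, follows. -/
theorem continuous_flow : Continuous fun p : Icc (0 : ℝ) T × Icc (0 : ℝ) T × Rd d =>
    flow hV hT p.1 p.2.1 p.2.2 := by
  rw [continuous_iff_continuousAt]
  rintro ⟨t₀, s₀, x₀⟩
  have hP : ∀ a : ℝ, Continuous fun b => |∫ q in a..b, V.speed q| := fun a =>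
    (intervalIntegral.continuous_primitive (fun a b => V.intervalIntegrable_speed a b) a).abs
  have hη : Tendsto (fun p : Icc (0 : ℝ) T × Icc (0 : ℝ) T × Rd d =>
      ‖p.2.2 - x₀‖ + |∫ q in (t₀ : ℝ)..p.1, V.speed q|) (𝓝 (t₀, s₀, x₀)) (𝓝 0) := by
    have hc : Continuous (fun p : Icc (0 : ℝ) T × Icc (0 : ℝ) T × Rd d =>
        ‖p.2.2 - x₀‖ + |∫ q in (t₀ : ℝ)..p.1, V.speed q|) :=
      Continuous.add (by fun_prop) ((hP t₀).comp (by fun_prop))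
    simpa using! hc.tendsto (t₀, s₀, x₀)
  have hσ : Tendsto (fun p : Icc (0 : ℝ) T × Icc (0 : ℝ) T × Rd d =>
      |∫ q in (s₀ : ℝ)..p.2.1, V.speed q|) (𝓝 (t₀, s₀, x₀)) (𝓝 0) := by
    have hc : Continuous (fun p : Icc (0 : ℝ) T × Icc (0 : ℝ) T × Rd d =>
        |∫ q in (s₀ : ℝ)..p.2.1, V.speed q|) := (hP s₀).comp (by fun_prop)
    simpa using! hc.tendsto (t₀, s₀, x₀)
  rw [Metric.continuousAt_iff']
  intro ε hε
  obtain ⟨δ, hδ, H⟩ := exists_stability_eps hV x₀ (half_pos hε)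
  filter_upwards [hη.eventually (gt_mem_nhds hδ), hσ.eventually (gt_mem_nhds (half_pos hε))]
  rintro ⟨t, s, x⟩ h1 h2
  have h3 := H t₀ t₀.2 _ _ _ _
    ((isApproxSolution_flow hV hT t.2 x).change_base t₀ x₀)
    (isApproxSolution_flow hV hT t₀.2 x₀) h1.le hδ.le s s.2
  have h4 := (isApproxSolution_flow hV hT t₀.2 x₀).norm_sub_le_integral_speed s₀.2 s.2
  rw [dist_eq_norm]
  refine (norm_sub_le_norm_sub_add_norm_sub _ (flow hV hT t₀ s x₀) _).trans_lt ?_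
  simp only at h2
  linarith

theorem isFlow_flow : IsFlow T V (flow hV hT) := by
  refine ⟨(continuous_flow hV hT).measurable, fun t ht x => ?_⟩
  have h := isApproxSolution_flow hV hT ht x
  refine ⟨h.isODESolution hT, h.apply_self ht, fun γ hγ hx s hs => ?_⟩
  subst hx
  rw [← eq_of_isApproxSolution_zero hV ht (hγ.isApproxSolution hT ht) h hs, clamp_of_mem hs]

theorem measurable_flow {t s : ℝ} (ht : t ∈ Icc 0 T) (hs : s ∈ Icc 0 T) :
    Measurable (flow hV hT t s) :=
  ((continuous_flow hV hT).comp (by fun_prop :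
    Continuous fun x : Rd d => ((⟨t, ht⟩, ⟨s, hs⟩, x) :
      Icc (0 : ℝ) T × Icc (0 : ℝ) T × Rd d))).measurable

end

/-! ### Signed measures and their transport by the flow -/

section

section SignedMeasure

variable {X : Type*} [MeasurableSpace X]

instance isFiniteMeasure_variation (μ : SignedMeasure X) : IsFiniteMeasure μ.variation := by
  rw [← SignedMeasure.totalVariation_eq_variation]
  infer_instance

theorem integrable_signedMeasure (μ : SignedMeasure X) {f : X → ℝ} (hf : Measurable f) {C : ℝ}
    (hC : ∀ x, |f x| ≤ C) : μ.Integrable f :=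
  Integrable.of_bound hf.aestronglyMeasurable C (Eventually.of_forall hC)

theorem abs_integral_signedMeasure_le (μ : SignedMeasure X) {f : X → ℝ} {C : ℝ}
    (hC : ∀ x, |f x| ≤ C) : |∫ᵛ x, f x ∂•μ| ≤ C * μ.variation.real univ := by
  have h := VectorMeasure.norm_integral_le_of_norm_le_const (μ := μ) (f := f)
    (B := ContinuousLinearMap.lsmul ℝ ℝ) (C := C) (Eventually.of_forall hC)
  rw [Real.norm_eq_abs] at h
  refine h.trans ?_
  rcases isEmpty_or_nonempty X with hX | ⟨⟨x⟩⟩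
  · simp [Measure.real, eq_empty_of_isEmpty (univ : Set X)]
  · have h0 : 0 ≤ C := (abs_nonneg _).trans (hC x)
    have h1 := ContinuousLinearMap.opNorm_lsmul_le (𝕜 := ℝ) (E := ℝ) (R := ℝ)
    exact mul_le_mul_of_nonneg_right (mul_le_of_le_one_right h0 h1) measureReal_nonneg

theorem integral_toSignedMeasure_real (ν : Measure X) [IsFiniteMeasure ν] (f : X → ℝ) :
    ∫ᵛ x, f x ∂•ν.toSignedMeasure = ∫ x, f x ∂ν := by
  rw [← VectorMeasure.integral_toSignedMeasure]
  congr 1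
  ext
  simp

/-- Splitting into positive measures gives access to the usual Fubini theorem and to densities. -/
theorem integral_eq_sub_jordan (μ : SignedMeasure X) {f : X → ℝ} (hf : Measurable f) {C : ℝ}
    (hC : ∀ x, |f x| ≤ C) : ∫ᵛ x, f x ∂•μ =
      ∫ x, f x ∂μ.toJordanDecomposition.posPart - ∫ x, f x ∂μ.toJordanDecomposition.negPart := by
  conv_lhs => rw [← μ.toSignedMeasure_toJordanDecomposition, JordanDecomposition.toSignedMeasure]
  rw [VectorMeasure.integral_sub_vectorMeasure (integrable_signedMeasure _ hf hC)
    (integrable_signedMeasure _ hf hC), integral_toSignedMeasure_real,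
    integral_toSignedMeasure_real]

theorem variation_univ_map_le (μ : SignedMeasure X) {Y : Type*} [MeasurableSpace Y] (φ : X → Y) :
    (μ.map φ).variation univ ≤ μ.variation univ := by
  by_cases hφ : Measurable φ
  · refine (VectorMeasure.variation_map_le univ).trans_eq ?_
    rw [Measure.map_apply hφ MeasurableSet.univ, preimage_univ]
  · rw [VectorMeasure.map, dif_neg hφ]
    simp

theorem integral_map_signedMeasure (μ : SignedMeasure X) {Y : Type*} [MeasurableSpace Y]
    {φ : X → Y} (hφ : Measurable φ) {f : Y → ℝ} (hf : Measurable f) {C : ℝ}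
    (hC : ∀ x, |f x| ≤ C) : ∫ᵛ y, f y ∂•(μ.map φ) = ∫ᵛ x, f (φ x) ∂•μ :=
  VectorMeasure.integral_map hφ hf.aestronglyMeasurable
    (integrable_signedMeasure μ (hf.comp hφ) fun x => hC (φ x))

/-- Fubini's theorem for a signed measure and the Lebesgue measure on an interval. -/
theorem integral_intervalIntegral_swap (μ : SignedMeasure X) {H : ℝ → X → ℝ} {v : ℝ → ℝ}
    (hH : Measurable (Function.uncurry H)) (hv : Integrable v)
    (hHv : ∀ᵐ r, ∀ x, |H r x| ≤ v r) (a b : ℝ) :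
    ∫ᵛ x, (∫ r in a..b, H r x) ∂•μ = ∫ r in a..b, ∫ᵛ x, H r x ∂•μ ∧
      Integrable fun r => ∫ᵛ x, H r x ∂•μ := by
  have hint : ∀ ν : Measure X, [IsFiniteMeasure ν] →
      Integrable (Function.uncurry H) ((volume : Measure ℝ).prod ν) := fun ν _ => by
    refine (hv.comp_fst ν).mono' hH.aestronglyMeasurable ?_
    filter_upwards [Measure.quasiMeasurePreserving_fst.ae hHv] with p hp using hp p.2
  have hswap : ∀ ν : Measure X, [IsFiniteMeasure ν] →
      ∫ x, (∫ r in a..b, H r x) ∂ν = ∫ r in a..b, ∫ x, H r x ∂ν := fun ν _ => by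
    refine (intervalIntegral_integral_swap ?_).symm
    exact (hint ν).mono_measure (Measure.prod_mono Measure.restrict_le_self le_rfl)
  have hvi : ∀ x, |∫ r in a..b, H r x| ≤ |∫ r in a..b, v r| := fun x => by
    rw [← Real.norm_eq_abs (∫ r in a..b, H r x)]
    refine intervalIntegral.norm_integral_le_abs_of_norm_le (ae_restrict_of_ae ?_)
      hv.intervalIntegrable
    filter_upwards [hHv] with r hr using hr x
  have hm : Measurable fun x => ∫ r in a..b, H r x := by
    simp only [intervalIntegral.intervalIntegral_eq_integral_uIoc]
    have h1 : Measurable fun x => ∫ r in uIoc a b, H r x :=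
      (hH.comp measurable_swap).stronglyMeasurable.integral_prod_right'.measurable
    exact (measurable_const (a := if a ≤ b then (1 : ℝ) else -1)).smul h1
  have hJ : ∀ᵐ r, ∫ᵛ x, H r x ∂•μ = ∫ x, H r x ∂μ.toJordanDecomposition.posPart -
      ∫ x, H r x ∂μ.toJordanDecomposition.negPart := by
    filter_upwards [hHv] with r hr using
      integral_eq_sub_jordan μ (hH.comp (measurable_const.prodMk measurable_id)) hr
  have hp : Integrable fun r => ∫ x, H r x ∂μ.toJordanDecomposition.posPart :=
    (hint μ.toJordanDecomposition.posPart).integral_prod_left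
  have hn : Integrable fun r => ∫ x, H r x ∂μ.toJordanDecomposition.negPart :=
    (hint μ.toJordanDecomposition.negPart).integral_prod_left
  refine ⟨?_, (integrable_congr hJ).2 (hp.sub hn)⟩
  rw [integral_eq_sub_jordan μ hm hvi, hswap, hswap,
    ← intervalIntegral.integral_sub hp.intervalIntegrable hn.intervalIntegrable]
  refine intervalIntegral.integral_congr_ae ?_
  filter_upwards [hJ] with r hr _ using hr.symm

end SignedMeasure

variable {d : ℕ} {T : ℝ}

/-- Both measures have integrable densities with respect to their sum. These densities have the same
integrals against test functions, hence agree almost everywhere. -/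
theorem measure_ext_of_integral_contDiff {P N : Measure (Rd d)} [IsFiniteMeasure P]
    [IsFiniteMeasure N] (h : ∀ u : Rd d → ℝ, ContDiff ℝ ∞ u → HasCompactSupport u →
      ∫ x, u x ∂P = ∫ x, u x ∂N) : P = N := by
  have hP : P ≪ P + N := Measure.absolutelyContinuous_of_le (Measure.le_add_right le_rfl)
  have hN : N ≪ P + N := Measure.absolutelyContinuous_of_le (Measure.le_add_left le_rfl)
  have : P.HaveLebesgueDecomposition (P + N) :=
    Measure.haveLebesgueDecomposition_of_sigmaFinite _ _
  have : N.HaveLebesgueDecomposition (P + N) :=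
    Measure.haveLebesgueDecomposition_of_sigmaFinite _ _
  have hPi : Integrable (fun x => (P.rnDeriv (P + N) x).toReal) (P + N) :=
    Measure.integrable_toReal_rnDeriv
  have hNi : Integrable (fun x => (N.rnDeriv (P + N) x).toReal) (P + N) :=
    Measure.integrable_toReal_rnDeriv
  have key : ∀ᵐ x ∂(P + N),
      (P.rnDeriv (P + N) x).toReal - (N.rnDeriv (P + N) x).toReal = 0 := by
    refine ae_eq_zero_of_integral_contDiff_smul_eq_zero (hPi.sub hNi).locallyIntegrable
      fun u hu hc => ?_
    obtain ⟨C, hC⟩ := hu.continuous.bounded_above_of_compact_support hc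
    have hum : AEStronglyMeasurable u (P + N) := hu.continuous.aestronglyMeasurable
    simp_rw [smul_eq_mul, mul_sub]
    rw [integral_sub (hPi.bdd_mul hum (Eventually.of_forall hC))
      (hNi.bdd_mul hum (Eventually.of_forall hC)), sub_eq_zero]
    have h1 := integral_rnDeriv_smul hP (f := u)
    have h2 := integral_rnDeriv_smul hN (f := u)
    simp_rw [smul_eq_mul, mul_comm _ (u _)] at h1 h2
    rw [h1, h2, h u hu hc]
  have hD : (P + N).withDensity (P.rnDeriv (P + N)) = (P + N).withDensity (N.rnDeriv (P + N)) := by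
    refine withDensity_congr_ae ?_
    filter_upwards [key, P.rnDeriv_lt_top (P + N), N.rnDeriv_lt_top (P + N)] with x h1 h2 h3
    exact (ENNReal.toReal_eq_toReal_iff' h2.ne h3.ne).1 (sub_eq_zero.1 h1)
  rwa [Measure.withDensity_rnDeriv_eq P (P + N) hP,
    Measure.withDensity_rnDeriv_eq N (P + N) hN] at hD

/-- The positive and negative parts of the difference integrate test functions equally, so they
coincide and the difference vanishes. -/
theorem signedMeasure_ext_of_integral_contDiff {μ ν : SignedMeasure (Rd d)}
    (h : ∀ u : Rd d → ℝ, ContDiff ℝ ∞ u → HasCompactSupport u →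
      ∫ᵛ x, u x ∂•μ = ∫ᵛ x, u x ∂•ν) : μ = ν := by
  rw [← sub_eq_zero]
  have key : (μ - ν).toJordanDecomposition.posPart = (μ - ν).toJordanDecomposition.negPart := by
    refine measure_ext_of_integral_contDiff fun u hu hc => ?_
    obtain ⟨C, hC⟩ := hu.continuous.bounded_above_of_compact_support hc
    have hm := hu.continuous.measurable
    rw [← sub_eq_zero, ← integral_eq_sub_jordan (μ - ν) hm hC,
      VectorMeasure.integral_sub_vectorMeasure (integrable_signedMeasure _ hm hC)
        (integrable_signedMeasure _ hm hC), h u hu hc, sub_self]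
  rw [← (μ - ν).toSignedMeasure_toJordanDecomposition, JordanDecomposition.toSignedMeasure]
  simp only [key, sub_self]

theorem abs_le_of_hasCompactSupport {u : Rd d → ℝ} (hu : ContDiff ℝ ∞ u)
    (hc : HasCompactSupport u) : ∃ C : ℝ, ∀ x, |u x| ≤ C :=
  hu.continuous.bounded_above_of_compact_support hc

theorem abs_sub_le_of_norm_fderiv_le {u : Rd d → ℝ} (hu : ContDiff ℝ ∞ u) {C : ℝ}
    (hC : ∀ x, ‖fderiv ℝ u x‖ ≤ C) (x y : Rd d) : |u x - u y| ≤ C * ‖x - y‖ :=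
  convex_univ.norm_image_sub_le_of_norm_fderiv_le (fun z _ => (hu.differentiable (by simp)) z)
    (fun z _ => hC z) (mem_univ y) (mem_univ x)

theorem continuous_fderiv_uncurry {u : Rd d → ℝ} (hu : ContDiff ℝ ∞ u) :
    Continuous fun p : Rd d × Rd d => fderiv ℝ u p.1 p.2 :=
  ((hu.continuous_fderiv (by simp)).comp continuous_fst).clm_apply continuous_snd

/-- The chain rule along a solution, in integral form. -/
theorem IsApproxSolution.comp_sub_eq_integral {V : FieldSpace d T} (hT : 0 ≤ T) {t : ℝ} {x : Rd d}
    {γ : ℝ → Rd d} (h : IsApproxSolution V t x 0 γ) {u : Rd d → ℝ} (hu : ContDiff ℝ ∞ u) {C : ℝ}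
    (hC : ∀ x, ‖fderiv ℝ u x‖ ≤ C) {a b : ℝ} (ha : a ∈ Icc 0 T) (hb : b ∈ Icc 0 T) :
    u (γ b) - u (γ a) = ∫ r in a..b, fderiv ℝ u (γ r) (V r (γ r)) := by
  have hC0 : 0 ≤ C := (norm_nonneg _).trans (hC 0)
  have hle : ∀ᵐ r, |fderiv ℝ u (γ r) (V r (γ r))| ≤ C * V.speed r := by
    filter_upwards [V.ae_norm_le_speed] with r hr
    exact ((fderiv ℝ u (γ r)).le_opNorm _).trans
      (mul_le_mul (hC _) (hr _) (norm_nonneg _) hC0)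
  have hint : Integrable fun r => fderiv ℝ u (γ r) (V r (γ r)) := by
    refine (V.integrable_speed.const_mul C).mono' ?_ hle
    exact ((continuous_fderiv_uncurry hu).measurable.comp
      (h.1.measurable.prodMk (V.measurable_along h.1.measurable))).aestronglyMeasurable
  rw [← uIcc_of_le hT] at ha hb
  refine AbsolutelyContinuousOnInterval.sub_eq_integral (f := fun r => u (γ r)) ?_
    hint.intervalIntegrable ?_ ha hb
  · refine absolutelyContinuousOnInterval_of_dist_le
      ((V.intervalIntegrable_speed 0 T).const_mul C) fun r hr s hs => ?_
    rw [uIcc_of_le hT] at hr hs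
    rw [dist_comm, Real.dist_eq, intervalIntegral.integral_const_mul, abs_mul, abs_of_nonneg hC0]
    exact (abs_sub_le_of_norm_fderiv_le hu hC _ _).trans
      (mul_le_mul_of_nonneg_left (h.norm_sub_le_integral_speed hr hs) hC0)
  · filter_upwards [ae_uIcc_of_ae_Ioo hT (h.isODESolution hT).2] with r hr hrI
    exact ((hu.differentiable (by simp)) (γ r)).hasFDerivAt.comp_hasDerivAt r (hr hrI)

theorem continuous_flow_clamp {V : FieldSpace d T} (hV : ∀ n, V ∈ approxSet d T n) (hT : 0 ≤ T)
    {S : ℝ} (hS : S ∈ Icc 0 T) :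
    Continuous fun p : ℝ × Rd d => flow hV hT S (clamp T p.1) p.2 := by
  have h1 : Continuous fun p : ℝ × Rd d => clamp T p.1 := continuous_clamp.comp continuous_fst
  have h2 : Continuous fun p : ℝ × Rd d => (⟨clamp T p.1, clamp_mem hT p.1⟩ : Icc (0 : ℝ) T) :=
    h1.subtype_mk _
  have h3 : Continuous fun p : ℝ × Rd d =>
      ((⟨clamp T p.1, clamp_mem hT p.1⟩, p.2) : Icc (0 : ℝ) T × Rd d) := h2.prodMk continuous_snd
  have hZ := (continuous_const (X := ℝ × Rd d) (y := (⟨S, hS⟩ : Icc (0 : ℝ) T))).prodMk h3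
  have h4 := (continuous_flow hV hT).comp hZ
  simp only [Function.comp_def] at h4
  exact h4

/-- The transport of a signed measure by the flow solves (PDE). -/
theorem isPDESolution_map_flow {V : FieldSpace d T} (hV : ∀ n, V ∈ approxSet d T n) (hT : 0 ≤ T)
    {S : ℝ} (hS : S ∈ Icc 0 T) (μ : SignedMeasure (Rd d)) :
    IsPDESolution T V fun t => μ.map (flow hV hT S t) := by
  have hY := continuous_flow_clamp hV hT hS
  constructor
  · intro f
    obtain ⟨C, hC⟩ : ∃ C : ℝ, ∀ x, |f x| ≤ C :=
      ⟨‖f.toBCF‖, fun x => f.toBCF.norm_coe_le_norm x⟩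
    have hf : Continuous f := f.continuous
    have h1 : ContinuousOn (fun t => ∫ᵛ x, f (flow hV hT S (clamp T t) x) ∂•μ) (Icc 0 T) := by
      refine VectorMeasure.continuousOn_of_dominated (bound := fun _ => C)
        (fun t _ => ?_) (fun t _ => Eventually.of_forall fun x => hC _) (integrable_const C)
        (Eventually.of_forall fun x => ?_)
      · exact (hf.comp (hY.comp (by fun_prop : Continuous fun x : Rd d => (t, x)))).aestronglyMeasurable
      · exact (hf.comp (hY.comp (by fun_prop : Continuous fun t : ℝ => (t, x)))).continuousOn
    refine h1.congr fun t ht => ?_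
    simp only [clamp_of_mem ht]
    exact integral_map_signedMeasure μ (measurable_flow hV hT hS ht) hf.measurable hC
  · intro u hu hc
    obtain ⟨C, hC⟩ := abs_le_of_hasCompactSupport hu hc
    obtain ⟨L, hL0, hL, -⟩ := exists_bounds_of_hasCompactSupport hu hc
    have hle : ∀ᵐ r, ∀ y, |fderiv ℝ u y (V r y)| ≤ L * V.speed r := by
      filter_upwards [V.ae_norm_le_speed] with r hr y
      exact ((fderiv ℝ u y).le_opNorm _).trans
        (mul_le_mul (hL _) (hr _) (norm_nonneg _) hL0)
    set H : ℝ → Rd d → ℝ := fun r x => fderiv ℝ u (flow hV hT S (clamp T r) x)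
      (V r (flow hV hT S (clamp T r) x)) with hH
    have hHm : Measurable (Function.uncurry H) :=
      (continuous_fderiv_uncurry hu).measurable.comp
        (hY.measurable.prodMk (V.property.1.comp (measurable_fst.prodMk hY.measurable)))
    have hHle : ∀ᵐ r, ∀ x, |H r x| ≤ L * V.speed r := by
      filter_upwards [hle] with r hr x using hr _
    have hFub := fun a b => integral_intervalIntegral_swap μ hHm
      (V.integrable_speed.const_mul L) hHle a b
    -- The chain rule along each trajectory, integrated in x and followed by Fubini, gives the weak
    -- formulation in integral form. Absolute continuity and the derivative both follow from it.
    have hsub : ∀ a ∈ Icc 0 T, ∀ b ∈ Icc 0 T, ∫ᵛ x, u x ∂•(μ.map (flow hV hT S b)) -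
        ∫ᵛ x, u x ∂•(μ.map (flow hV hT S a)) = ∫ r in a..b, ∫ᵛ x, H r x ∂•μ := by
      intro a ha b hb
      have hum := hu.continuous.measurable
      have hua : Measurable fun x => u (flow hV hT S a x) := hum.comp (measurable_flow hV hT hS ha)
      have hub : Measurable fun x => u (flow hV hT S b x) := hum.comp (measurable_flow hV hT hS hb)
      rw [integral_map_signedMeasure μ (measurable_flow hV hT hS ha) hum hC,
        integral_map_signedMeasure μ (measurable_flow hV hT hS hb) hum hC,
        ← VectorMeasure.integral_fun_sub
          (integrable_signedMeasure μ hub fun x => hC _)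
          (integrable_signedMeasure μ hua fun x => hC _),
        ← (hFub a b).1]
      congr with x
      rw [(isApproxSolution_flow hV hT hS x).comp_sub_eq_integral hT hu hL ha hb]
      refine intervalIntegral.integral_congr fun r hr => ?_
      have hr' : r ∈ Icc 0 T := ordConnected_Icc.uIcc_subset ha hb hr
      simp only [hH, clamp_of_mem hr']
    have hGi := (hFub 0 T).2.intervalIntegrable (a := 0) (b := T)
    refine ⟨absolutelyContinuousOnInterval_of_dist_le hGi.norm fun r hr s hs => ?_, ?_⟩
    · have hGrs := hGi.norm.mono_set (uIcc_subset_uIcc hr hs)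
      rw [uIcc_of_le hT] at hr hs
      rw [dist_comm, dist_eq_norm, hsub r hr s hs]
      exact intervalIntegral.norm_integral_le_abs_of_norm_le
        (Eventually.of_forall fun _ => le_rfl) hGrs
    · have h1 := ae_hasDerivAt_of_sub_eq_integral
        (f := fun s => ∫ᵛ x, u x ∂•(μ.map (flow hV hT S s))) hT hGi
        (fun s hs => hsub 0 (left_mem_Icc.2 hT) s hs)
      filter_upwards [h1, ae_restrict_of_ae hle, ae_restrict_mem measurableSet_Ioo] with t h1 h2 h3
      have h4 : ∫ᵛ x, fderiv ℝ u x (V t x) ∂•(μ.map (flow hV hT S t)) = ∫ᵛ x, H t x ∂•μ := by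
        have hm : Measurable fun x => fderiv ℝ u x (V t x) :=
          (continuous_fderiv_uncurry hu).measurable.comp
            (measurable_id.prodMk (V.continuous_apply t).measurable)
        simp only [hH, clamp_of_mem (Ioo_subset_Icc_self h3)]
        exact integral_map_signedMeasure μ
          (measurable_flow hV hT hS (Ioo_subset_Icc_self h3)) hm h2
      rw [h4]
      exact h1

theorem normBounded_map (T : ℝ) (μ : SignedMeasure (Rd d)) (X : ℝ → Rd d → Rd d) :
    NormBounded T fun t => μ.map (X t) :=
  ⟨(μ.variation univ).toNNReal, fun t _ => (variation_univ_map_le μ (X t)).trans_eq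
    (ENNReal.coe_toNNReal (measure_ne_top _ _)).symm⟩

theorem map_flow_self {V : FieldSpace d T} (hV : ∀ n, V ∈ approxSet d T n) (hT : 0 ≤ T)
    {S : ℝ} (hS : S ∈ Icc 0 T) (μ : SignedMeasure (Rd d)) : μ.map (flow hV hT S S) = μ := by
  have h : flow hV hT S S = id := by
    ext1 x
    exact (isApproxSolution_flow hV hT hS x).apply_self hS
  rw [h, VectorMeasure.map_id]

end

/-! ### Test functions under Euler steps -/

section

variable {d : ℕ} {T : ℝ}

/-- Quantitative bounds on a test function: the radius of a ball which carries it, a bound of its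
differential, and a Lipschitz constant of its differential. -/
structure TestBounds (u : Rd d → ℝ) (R ℓ q : ℝ) : Prop where
  contDiff : ContDiff ℝ ∞ u
  eq_zero : ∀ x, R < ‖x‖ → u x = 0
  norm_fderiv_le : ∀ x, ‖fderiv ℝ u x‖ ≤ ℓ
  norm_fderiv_sub_le : ∀ x y, ‖fderiv ℝ u x - fderiv ℝ u y‖ ≤ q * ‖x - y‖

theorem hasCompactSupport_of_eq_zero {u : Rd d → ℝ} {R : ℝ} (h : ∀ x, R < ‖x‖ → u x = 0) :
    HasCompactSupport u :=
  HasCompactSupport.of_support_subset_isCompact (isCompact_closedBall (0 : Rd d) R) fun x hx => by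
    by_contra hn
    rw [mem_closedBall_zero_iff, not_le] at hn
    exact hx (h x hn)

theorem exists_testBounds {u : Rd d → ℝ} (hu : ContDiff ℝ ∞ u) (hc : HasCompactSupport u) :
    ∃ R ℓ q : ℝ, 0 ≤ ℓ ∧ 0 ≤ q ∧ TestBounds u R ℓ q := by
  obtain ⟨C, hC0, h1, h2⟩ := exists_bounds_of_hasCompactSupport hu hc
  obtain ⟨R, hR⟩ := hc.isCompact.isBounded.subset_closedBall (0 : Rd d)
  refine ⟨R, C, C, hC0, hC0, hu, fun x hx => ?_, h1, h2⟩
  by_contra hn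
  have := hR (subset_tsupport _ hn)
  rw [mem_closedBall_zero_iff] at this
  exact absurd hx this.not_gt

namespace TestBounds

variable {u : Rd d → ℝ} {R ℓ q : ℝ}

theorem hasCompactSupport (h : TestBounds u R ℓ q) : HasCompactSupport u :=
  hasCompactSupport_of_eq_zero h.eq_zero

theorem fderiv_eq_zero (h : TestBounds u R ℓ q) {x : Rd d} (hx : R < ‖x‖) : fderiv ℝ u x = 0 := by
  have h1 : u =ᶠ[𝓝 x] fun _ => 0 := by
    filter_upwards [(isOpen_lt continuous_const continuous_norm).mem_nhds hx] with y hy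
      using h.eq_zero y hy
  rw [h1.fderiv_eq]
  simp

/-- The mean value inequality on the ball of radius ‖w‖ around x suffices; it gives `q` instead of
the sharp q/2, which is immaterial. -/
theorem taylor (h : TestBounds u R ℓ q) (hq : 0 ≤ q) (x w : Rd d) :
    |u (x + w) - u x - fderiv ℝ u x w| ≤ q * ‖w‖ ^ 2 := by
  have h1 : ‖u (x + w) - u x - fderiv ℝ u x (x + w - x)‖ ≤ q * ‖w‖ * ‖x + w - x‖ := by
    refine (convex_closedBall x ‖w‖).norm_image_sub_le_of_norm_fderiv_le'
      (fun z _ => (h.contDiff.differentiable (by simp)) z) (fun z hz => ?_)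
      (Metric.mem_closedBall_self (norm_nonneg w)) (by simp)
    refine (h.norm_fderiv_sub_le z x).trans (mul_le_mul_of_nonneg_left ?_ hq)
    rwa [mem_closedBall_iff_norm] at hz
  rw [add_sub_cancel_left, Real.norm_eq_abs] at h1
  linarith

end TestBounds

namespace SmoothField

variable (W : SmoothField d)

/-- The displacement of an Euler step of `W` from time `a` to time `b`. -/
def displacement (a b : ℝ) (x : Rd d) : Rd d := ∑ i, W.ψ i x • ∫ r in a..b, W.f i r

theorem norm_integral_f_le (i : W.ι) (a b : ℝ) : ‖∫ r in a..b, W.f i r‖ ≤ W.B * |b - a| :=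
  intervalIntegral.norm_integral_le_of_norm_le_const fun r _ => W.norm_f_le i r

theorem intervalIntegrable_f (i : W.ι) (a b : ℝ) : IntervalIntegrable (W.f i) volume a b :=
  (intervalIntegrable_const (c := W.B)).mono_fun' (W.measurable_f i).aestronglyMeasurable
    (Eventually.of_forall fun r => W.norm_f_le i r)

/-- This is where the separated form of `W` pays off: the time integral acts on the coefficients
only, so the step is smooth in x with explicit bounds and nothing is differentiated under an
integral. -/
theorem displacement_eq_integral (a b : ℝ) (x : Rd d) :
    W.displacement a b x = ∫ r in a..b, W.eval r x := by
  unfold displacement eval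
  have h : ∀ i ∈ Finset.univ, IntervalIntegrable (fun r => W.ψ i x • W.f i r) volume a b :=
    fun i _ => (W.intervalIntegrable_f i a b).smul (W.ψ i x)
  rw [intervalIntegral.integral_finsetSum h]
  simp_rw [intervalIntegral.integral_smul]

theorem norm_displacement_le (a b : ℝ) (x : Rd d) : ‖W.displacement a b x‖ ≤ W.bound * |b - a| := by
  rw [displacement_eq_integral]
  exact intervalIntegral.norm_integral_le_of_norm_le_const fun r _ => W.norm_eval_le r x

theorem contDiff_displacement (a b : ℝ) : ContDiff ℝ ∞ (W.displacement a b) :=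
  ContDiff.sum fun i _ => (W.contDiff_ψ i).smul contDiff_const

theorem contDiff_eval (t : ℝ) : ContDiff ℝ ∞ (W.eval t) :=
  ContDiff.sum fun i _ => (W.contDiff_ψ i).smul contDiff_const

theorem fderiv_displacement (a b : ℝ) (x : Rd d) : fderiv ℝ (W.displacement a b) x =
    ∑ i, (fderiv ℝ (W.ψ i) x).smulRight (∫ r in a..b, W.f i r) := by
  refine HasFDerivAt.fderiv (HasFDerivAt.fun_sum fun i _ => ?_)
  exact (((W.contDiff_ψ i).differentiable (by simp)) x).hasFDerivAt.smul_const _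

theorem norm_fderiv_displacement_le (a b : ℝ) (x : Rd d) :
    ‖fderiv ℝ (W.displacement a b) x‖ ≤ W.lip * |b - a| := by
  rw [fderiv_displacement]
  refine (norm_sum_le_of_le (n := fun _ => W.L * (W.B * |b - a|)) _ fun i _ => ?_).trans_eq ?_
  · rw [ContinuousLinearMap.norm_smulRight_apply]
    exact mul_le_mul (W.norm_fderiv_ψ_le i x) (W.norm_integral_f_le i a b) (norm_nonneg _)
      W.L_nonneg
  · simp [bound, lip]
    ring

theorem norm_fderiv_displacement_sub_le (a b : ℝ) (x y : Rd d) :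
    ‖fderiv ℝ (W.displacement a b) x - fderiv ℝ (W.displacement a b) y‖ ≤
      W.bound * W.Q * |b - a| * ‖x - y‖ := by
  rw [fderiv_displacement, fderiv_displacement, ← Finset.sum_sub_distrib]
  refine (norm_sum_le_of_le (n := fun _ => W.Q * ‖x - y‖ * (W.B * |b - a|)) _
    fun i _ => ?_).trans_eq ?_
  · have h : (fderiv ℝ (W.ψ i) x).smulRight (∫ r in a..b, W.f i r) -
        (fderiv ℝ (W.ψ i) y).smulRight (∫ r in a..b, W.f i r) =
        (fderiv ℝ (W.ψ i) x - fderiv ℝ (W.ψ i) y).smulRight (∫ r in a..b, W.f i r) := by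
      ext z
      simp [sub_smul]
    rw [h, ContinuousLinearMap.norm_smulRight_apply]
    exact mul_le_mul (W.norm_fderiv_ψ_sub_le i x y) (W.norm_integral_f_le i a b) (norm_nonneg _)
      (mul_nonneg W.Q_nonneg (norm_nonneg _))
  · simp [bound]
    ring

/-- Composition of a test function with an Euler step. -/
theorem testBounds_comp_step {u : Rd d → ℝ} {R ℓ q β : ℝ} (h : TestBounds u R ℓ q) (hℓ : 0 ≤ ℓ)
    (hq : 0 ≤ q) {a b : ℝ} (hβ : ∀ x, ‖W.displacement a b x‖ ≤ β) :
    TestBounds (fun x => u (x + W.displacement a b x)) (R + β) (ℓ * (1 + W.lip * |b - a|))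
      (q * (1 + W.lip * |b - a|) ^ 2 + ℓ * (W.bound * W.Q * |b - a|)) := by
  set Φ : Rd d → Rd d := fun x => x + W.displacement a b x with hΦ
  set κ := W.lip * |b - a|
  have hκ : 0 ≤ κ := mul_nonneg W.lip_nonneg (abs_nonneg _)
  have hD : ∀ x, HasFDerivAt (W.displacement a b) (fderiv ℝ (W.displacement a b) x) x := fun x =>
    (((W.contDiff_displacement a b).differentiable (by simp)) x).hasFDerivAt
  have hΦd : ∀ x, HasFDerivAt Φ
      (ContinuousLinearMap.id ℝ (Rd d) + fderiv ℝ (W.displacement a b) x) x := fun x =>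
    (hasFDerivAt_id x).add (hD x)
  have hΦ' : ∀ x, ‖ContinuousLinearMap.id ℝ (Rd d) + fderiv ℝ (W.displacement a b) x‖ ≤ 1 + κ :=
    fun x => (norm_add_le _ _).trans (add_le_add ContinuousLinearMap.norm_id_le
      (W.norm_fderiv_displacement_le a b x))
  have hΦl : ∀ x y, ‖Φ x - Φ y‖ ≤ (1 + κ) * ‖x - y‖ := fun x y =>
    convex_univ.norm_image_sub_le_of_norm_hasFDerivWithin_le
      (fun z _ => (hΦd z).hasFDerivWithinAt) (fun z _ => hΦ' z) (mem_univ y) (mem_univ x)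
  have hcomp : ∀ x, fderiv ℝ (fun x => u (Φ x)) x = (fderiv ℝ u (Φ x)).comp
      (ContinuousLinearMap.id ℝ (Rd d) + fderiv ℝ (W.displacement a b) x) := fun x =>
    HasFDerivAt.fderiv
      (HasFDerivAt.comp x (((h.contDiff.differentiable (by simp)) (Φ x)).hasFDerivAt) (hΦd x))
  refine ⟨h.contDiff.comp (contDiff_id.add (W.contDiff_displacement a b)), fun x hx => ?_,
    fun x => ?_, fun x y => ?_⟩
  · refine h.eq_zero _ ?_
    have h1 := norm_sub_le (x + W.displacement a b x) (W.displacement a b x)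
    rw [add_sub_cancel_right] at h1
    linarith [hβ x]
  · rw [hcomp]
    exact (ContinuousLinearMap.opNorm_comp_le _ _).trans
      (mul_le_mul (h.norm_fderiv_le _) (hΦ' x) (norm_nonneg _) hℓ)
  · rw [hcomp, hcomp]
    -- The variation of the differential of `u` costs `q` times (1 + κ)², one factor from the
    -- Lipschitz constant of `Φ` and one from its differential; the variation of the differential of
    -- `Φ` costs the term in `ℓ`.
    have h1 : (fderiv ℝ u (Φ x)).comp
          (ContinuousLinearMap.id ℝ (Rd d) + fderiv ℝ (W.displacement a b) x) -
        (fderiv ℝ u (Φ y)).comp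
          (ContinuousLinearMap.id ℝ (Rd d) + fderiv ℝ (W.displacement a b) y) =
        (fderiv ℝ u (Φ x) - fderiv ℝ u (Φ y)).comp
          (ContinuousLinearMap.id ℝ (Rd d) + fderiv ℝ (W.displacement a b) x) +
        (fderiv ℝ u (Φ y)).comp
          (fderiv ℝ (W.displacement a b) x - fderiv ℝ (W.displacement a b) y) := by
      ext z
      simp
      ring
    rw [h1]
    refine (norm_add_le _ _).trans ?_
    have h2 : ‖fderiv ℝ u (Φ x) - fderiv ℝ u (Φ y)‖ ≤ q * ((1 + κ) * ‖x - y‖) :=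
      (h.norm_fderiv_sub_le _ _).trans (mul_le_mul_of_nonneg_left (hΦl x y) hq)
    have h3 := (ContinuousLinearMap.opNorm_comp_le (fderiv ℝ u (Φ x) - fderiv ℝ u (Φ y)) _).trans
      (mul_le_mul h2 (hΦ' x) (norm_nonneg _) (by positivity))
    have h4 := (ContinuousLinearMap.opNorm_comp_le (fderiv ℝ u (Φ y)) _).trans
      (mul_le_mul (h.norm_fderiv_le (Φ y)) (W.norm_fderiv_displacement_sub_le a b x y)
        (norm_nonneg _) hℓ)
    refine (add_le_add h3 h4).trans_eq ?_
    ring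

/-- The derivative of a test function in the direction of the field `W`, at a fixed time. -/
theorem directional_bounds {u : Rd d → ℝ} {R ℓ q : ℝ} (h : TestBounds u R ℓ q) (hq : 0 ≤ q)
    (hℓ : 0 ≤ ℓ) (r : ℝ) :
    ContDiff ℝ ∞ (fun x => fderiv ℝ u x (W.eval r x)) ∧
      HasCompactSupport (fun x => fderiv ℝ u x (W.eval r x)) ∧
      ∀ x, ‖fderiv ℝ (fun x => fderiv ℝ u x (W.eval r x)) x‖ ≤ W.lip * ℓ + W.bound * q := by
  refine ⟨(h.contDiff.fderiv_right (by simp)).clm_apply (W.contDiff_eval r),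
    hasCompactSupport_of_eq_zero (R := R) fun x hx => by rw [h.fderiv_eq_zero hx]; rfl,
    fun x => ?_⟩
  have hK := W.lip_nonneg
  have hB := W.bound_nonneg
  have hC : 0 ≤ W.lip * ℓ + W.bound * q := by positivity
  refine norm_fderiv_le_of_lip' ℝ hC (Eventually.of_forall fun y => ?_)
  have h1 : fderiv ℝ u y (W.eval r y) - fderiv ℝ u x (W.eval r x) =
      (fderiv ℝ u y - fderiv ℝ u x) (W.eval r y) + fderiv ℝ u x (W.eval r y - W.eval r x) := by
    simp
  rw [h1]
  refine (norm_add_le _ _).trans ?_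
  have h2 := ((fderiv ℝ u y - fderiv ℝ u x).le_opNorm (W.eval r y)).trans
    (mul_le_mul (h.norm_fderiv_sub_le y x) (W.norm_eval_le r y) (norm_nonneg _) (by positivity))
  have h3 := ((fderiv ℝ u x).le_opNorm (W.eval r y - W.eval r x)).trans
    (mul_le_mul (h.norm_fderiv_le x) (W.norm_eval_sub_le r y x) (norm_nonneg _) hℓ)
  linarith

end SmoothField

end

/-! ### Solutions of (PDE) along Euler steps -/

section

variable {d : ℕ} {T : ℝ}

/-- Integrals in absolute value let the forward and backward directions of time share one argument,
since t may precede or follow S. -/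
theorem abs_intervalIntegral_add_abs {g : ℝ → ℝ} (hg : Integrable g) (h0 : ∀ t, 0 ≤ g t)
    {a b c : ℝ} (hb : b ∈ uIcc a c) :
    |∫ r in a..b, g r| + |∫ r in b..c, g r| = |∫ r in a..c, g r| := by
  have h := intervalIntegral.integral_add_adjacent_intervals (hg.intervalIntegrable (a := a) (b := b))
    (hg.intervalIntegrable (a := b) (b := c))
  rw [← h]
  rcases mem_uIcc.1 hb with ⟨h1, h2⟩ | ⟨h1, h2⟩
  · have h3 := intervalIntegral.integral_nonneg_of_forall (μ := volume) h1 h0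
    have h4 := intervalIntegral.integral_nonneg_of_forall (μ := volume) h2 h0
    rw [abs_of_nonneg h3, abs_of_nonneg h4, abs_of_nonneg (add_nonneg h3 h4)]
  · have h3 := intervalIntegral.integral_nonneg_of_forall (μ := volume) h1 h0
    have h4 := intervalIntegral.integral_nonneg_of_forall (μ := volume) h2 h0
    rw [intervalIntegral.integral_symm b a, intervalIntegral.integral_symm c b, ← neg_add,
      abs_neg, abs_neg, abs_neg, abs_of_nonneg h3, abs_of_nonneg h4,
      abs_of_nonneg (add_nonneg h4 h3)]

namespace IsPDESolution

variable {V : FieldSpace d T} {ν : ℝ → SignedMeasure (Rd d)}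

/-- The weak formulation of (PDE), in integral form. -/
theorem integral_sub_eq (hT : 0 ≤ T) (hν : IsPDESolution T V ν) {u : Rd d → ℝ}
    (hu : ContDiff ℝ ∞ u) (hc : HasCompactSupport u) {a b : ℝ} (ha : a ∈ Icc 0 T)
    (hb : b ∈ Icc 0 T) :
    IntervalIntegrable (fun r => ∫ᵛ x, fderiv ℝ u x (V r x) ∂•(ν r)) volume a b ∧
      ∫ᵛ x, u x ∂•(ν b) - ∫ᵛ x, u x ∂•(ν a) =
        ∫ r in a..b, ∫ᵛ x, fderiv ℝ u x (V r x) ∂•(ν r) := by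
  obtain ⟨h1, h2⟩ := hν.2 u hu hc
  have h3 := ae_uIcc_of_ae_Ioo hT h2
  rw [← uIcc_of_le hT] at ha hb
  have h4 : IntervalIntegrable (fun r => ∫ᵛ x, fderiv ℝ u x (V r x) ∂•(ν r)) volume 0 T := by
    refine h1.intervalIntegrable_deriv.congr_ae ?_
    filter_upwards [ae_restrict_of_ae h3, ae_restrict_mem measurableSet_uIoc] with t ht1 ht2
      using (ht1 (uIoc_subset_uIcc ht2)).deriv
  exact ⟨h4.mono_set (uIcc_subset_uIcc ha hb),
    AbsolutelyContinuousOnInterval.sub_eq_integral h1 h4 h3 ha hb⟩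

theorem abs_integral_sub_le (hT : 0 ≤ T) (hν : IsPDESolution T V ν) {M : ℝ}
    (hM : ∀ t ∈ Icc 0 T, (ν t).variation.real univ ≤ M) {u : Rd d → ℝ}
    (hu : ContDiff ℝ ∞ u) (hc : HasCompactSupport u) {C : ℝ} (hC : ∀ x, ‖fderiv ℝ u x‖ ≤ C)
    {a b : ℝ} (ha : a ∈ Icc 0 T) (hb : b ∈ Icc 0 T) :
    |∫ᵛ x, u x ∂•(ν b) - ∫ᵛ x, u x ∂•(ν a)| ≤ C * M * |∫ r in a..b, V.speed r| := by
  have hC0 : 0 ≤ C := (norm_nonneg _).trans (hC 0)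
  have hM0 : 0 ≤ M := measureReal_nonneg.trans (hM a ha)
  rw [(hν.integral_sub_eq hT hu hc ha hb).2, ← Real.norm_eq_abs]
  refine (intervalIntegral.norm_integral_le_abs_of_norm_le (g := fun r => C * M * V.speed r) ?_
    ((V.intervalIntegrable_speed a b).const_mul _)).trans_eq ?_
  · filter_upwards [ae_restrict_of_ae V.ae_norm_le_speed, ae_restrict_mem measurableSet_uIoc]
      with r hr1 hr2
    have hr3 : r ∈ Icc 0 T := ordConnected_Icc.uIcc_subset ha hb (uIoc_subset_uIcc hr2)
    rw [Real.norm_eq_abs]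
    refine (abs_integral_signedMeasure_le (ν r) (C := C * V.speed r) fun x => ?_).trans ?_
    · rw [← Real.norm_eq_abs]
      exact ((fderiv ℝ u x).le_opNorm _).trans
        (mul_le_mul (hC x) (hr1 x) (norm_nonneg _) hC0)
    · calc C * V.speed r * (ν r).variation.real univ ≤ C * V.speed r * M :=
            mul_le_mul_of_nonneg_left (hM r hr3) (mul_nonneg hC0 (V.speed_nonneg r))
        _ = C * M * V.speed r := by ring
  · rw [intervalIntegral.integral_const_mul, abs_mul, abs_of_nonneg (mul_nonneg hC0 hM0)]

/-- Over a short time, a solution of (PDE) is almost transported by an Euler step of a smooth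
approximation of the field. -/
theorem abs_integral_sub_step_le (hT : 0 ≤ T) (hν : IsPDESolution T V ν) {M : ℝ}
    (hM : ∀ t ∈ Icc 0 T, (ν t).variation.real univ ≤ M) {W : SmoothField d} {e b : ℝ → ℝ} {n : ℕ}
    (he : Integrable e) (he0 : ∀ t, 0 ≤ e t)
    (hb : Integrable b) (hWb : ∀ t x, ‖W.eval t x‖ ≤ b t)
    (hVW : ∀ᵐ t, ∀ x, ‖x‖ ≤ n → ‖V t x - W.eval t x‖ ≤ e t)
    {u : Rd d → ℝ} {R ℓ q : ℝ}
    (h : TestBounds u R ℓ q) (hℓ : 0 ≤ ℓ) (hq : 0 ≤ q) (hR : R ≤ n)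
    {s t : ℝ} (hs : s ∈ Icc 0 T) (ht : t ∈ Icc 0 T) :
    |∫ᵛ x, u x ∂•(ν t) - ∫ᵛ x, u (x + W.displacement s t x) ∂•(ν s)| ≤
      M * (ℓ * |∫ r in s..t, e r| +
        ((W.lip * ℓ + W.bound * q) * (|t - s| * |∫ r in s..t, V.speed r|) +
          q * (W.bound * |t - s|) ^ 2)) := by
  have hM0 : 0 ≤ M := measureReal_nonneg.trans (hM s hs)
  have hK := W.lip_nonneg
  have hB := W.bound_nonneg
  set C := W.lip * ℓ + W.bound * q with hCdef
  have hC0 : 0 ≤ C := by positivity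
  set H : ℝ → Rd d → ℝ := fun r x => fderiv ℝ u x (W.eval r x)
  have hHm : Measurable (Function.uncurry H) :=
    (continuous_fderiv_uncurry h.contDiff).measurable.comp
      (measurable_snd.prodMk W.measurable_uncurry_eval)
  have hHb : ∀ r x, |H r x| ≤ ℓ * b r := fun r x =>
    ((fderiv ℝ u x).le_opNorm _).trans
      (mul_le_mul (h.norm_fderiv_le x) (hWb r x) (norm_nonneg _) hℓ)
  have hHi : ∀ x, ∫ r in s..t, H r x = fderiv ℝ u x (W.displacement s t x) := fun x => by
    rw [W.displacement_eq_integral]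
    exact ContinuousLinearMap.intervalIntegral_comp_comm (fderiv ℝ u x)
      (W.intervalIntegrable_along measurable_const s t)
  obtain ⟨hswap, hGi⟩ := integral_intervalIntegral_swap (ν s) hHm (hb.const_mul ℓ)
    (Eventually.of_forall hHb) s t
  simp only [hHi] at hswap
  obtain ⟨hFi, hF⟩ := hν.integral_sub_eq hT h.contDiff h.hasCompactSupport hs ht
  obtain ⟨Cu, hCu⟩ := abs_le_of_hasCompactSupport h.contDiff h.hasCompactSupport
  have hD := (W.contDiff_displacement s t).continuous
  have hD' : Continuous fun x => u (x + W.displacement s t x) :=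
    h.contDiff.continuous.comp (continuous_id.add hD)
  have hE : Continuous fun x => fderiv ℝ u x (W.displacement s t x) :=
    (continuous_fderiv_uncurry h.contDiff).comp (continuous_id.prodMk hD)
  have hEb : ∀ x, |fderiv ℝ u x (W.displacement s t x)| ≤ ℓ * (W.bound * |t - s|) := fun x =>
    ((fderiv ℝ u x).le_opNorm _).trans
      (mul_le_mul (h.norm_fderiv_le x) (W.norm_displacement_le s t x) (norm_nonneg _) hℓ)
  have hi1 := integrable_signedMeasure (ν s) hD'.measurable (fun x => hCu _)
  have hi2 := integrable_signedMeasure (ν s) h.contDiff.continuous.measurable hCu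
  have hi3 := integrable_signedMeasure (ν s) hE.measurable hEb
  -- First error: linearising the Euler step, of second order in t - s.
  have htay : |∫ᵛ x, u (x + W.displacement s t x) ∂•(ν s) - ∫ᵛ x, u x ∂•(ν s) -
      ∫ᵛ x, fderiv ℝ u x (W.displacement s t x) ∂•(ν s)| ≤ q * (W.bound * |t - s|) ^ 2 * M := by
    have hi12 : (ν s).Integrable fun x => u (x + W.displacement s t x) - u x := hi1.sub hi2
    rw [← VectorMeasure.integral_fun_sub hi1 hi2, ← VectorMeasure.integral_fun_sub hi12 hi3]
    refine (abs_integral_signedMeasure_le (ν s) (C := q * (W.bound * |t - s|) ^ 2)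
      fun x => ?_).trans (mul_le_mul_of_nonneg_left (hM s hs) (by positivity))
    refine (h.taylor hq x _).trans (mul_le_mul_of_nonneg_left ?_ hq)
    exact pow_le_pow_left₀ (norm_nonneg _) (W.norm_displacement_le s t x) 2
  have hmain : |∫ᵛ x, u x ∂•(ν t) - ∫ᵛ x, u x ∂•(ν s) -
      ∫ᵛ x, fderiv ℝ u x (W.displacement s t x) ∂•(ν s)| ≤
      M * ℓ * |∫ r in s..t, e r| + C * M * |∫ r in s..t, V.speed r| * |t - s| := by
    rw [hF, hswap, ← intervalIntegral.integral_sub hFi hGi.intervalIntegrable,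
      ← Real.norm_eq_abs (∫ r in s..t, _)]
    have hgi := (he.intervalIntegrable (a := s) (b := t)).const_mul (M * ℓ)
    refine (intervalIntegral.norm_integral_le_abs_of_norm_le
      (g := fun r => M * ℓ * e r + C * M * |∫ r in s..t, V.speed r|) ?_
      (hgi.add intervalIntegrable_const)).trans ?_
    · filter_upwards [ae_restrict_of_ae hVW, ae_restrict_of_ae V.ae_norm_le_speed,
        ae_restrict_mem measurableSet_uIoc] with r hr1 hr2 hr3
      have hr4 : r ∈ Icc 0 T := ordConnected_Icc.uIcc_subset hs ht (uIoc_subset_uIcc hr3)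
      obtain ⟨hg1, hg2, hg3⟩ := W.directional_bounds h hq hℓ r
      have hV1 : Continuous fun x => fderiv ℝ u x (V r x) :=
        (continuous_fderiv_uncurry h.contDiff).comp (continuous_id.prodMk (V.continuous_apply r))
      have hV2 : ∀ x, |fderiv ℝ u x (V r x)| ≤ ℓ * V.speed r := fun x =>
        ((fderiv ℝ u x).le_opNorm _).trans
          (mul_le_mul (h.norm_fderiv_le x) (hr2 x) (norm_nonneg _) hℓ)
      -- Second error: replacing `V` by `W`. Outside the ball of radius n nothing is lost, as the
      -- differential of `u` vanishes there.
      have h1 : |∫ᵛ x, fderiv ℝ u x (V r x) ∂•(ν r) - ∫ᵛ x, H r x ∂•(ν r)| ≤ ℓ * e r * M := by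
        rw [← VectorMeasure.integral_fun_sub (integrable_signedMeasure (ν r) hV1.measurable hV2)
          (integrable_signedMeasure (ν r) hg1.continuous.measurable (hHb r))]
        refine (abs_integral_signedMeasure_le (ν r) (C := ℓ * e r) fun x => ?_).trans
          (mul_le_mul_of_nonneg_left (hM r hr4) (mul_nonneg hℓ (he0 r)))
        rw [← map_sub, ← Real.norm_eq_abs]
        by_cases hx : ‖x‖ ≤ n
        · exact ((fderiv ℝ u x).le_opNorm _).trans
            (mul_le_mul (h.norm_fderiv_le x) (hr1 x hx) (norm_nonneg _) hℓ)
        · rw [h.fderiv_eq_zero (hR.trans_lt (not_le.1 hx))]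
          simpa using mul_nonneg hℓ (he0 r)
      -- Third error: freezing the measure at time s. The function `H r` is itself an admissible
      -- test function because `W` is smooth in x, so (PDE) controls its integral between s and r.
      have h2 : |∫ᵛ x, H r x ∂•(ν r) - ∫ᵛ x, H r x ∂•(ν s)| ≤
          C * M * |∫ r in s..t, V.speed r| := by
        refine (hν.abs_integral_sub_le hT hM hg1 hg2 hg3 hs hr4).trans
          (mul_le_mul_of_nonneg_left ?_ (mul_nonneg hC0 hM0))
        exact intervalIntegral.abs_integral_mono_interval
          (uIoc_subset_uIoc_of_uIcc_subset_uIcc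
            (uIcc_subset_uIcc left_mem_uIcc (uIoc_subset_uIcc hr3)))
          (Eventually.of_forall V.speed_nonneg) (V.intervalIntegrable_speed s t)
      rw [Real.norm_eq_abs]
      refine (abs_sub_le _ (∫ᵛ x, H r x ∂•(ν r)) _).trans ((add_le_add h1 h2).trans_eq ?_)
      ring
    · rw [intervalIntegral.integral_add hgi intervalIntegrable_const,
        intervalIntegral.integral_const_mul, intervalIntegral.integral_const, smul_eq_mul]
      refine (abs_add_le _ _).trans_eq ?_
      rw [abs_mul, abs_mul (t - s), abs_of_nonneg (mul_nonneg hM0 hℓ),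
        abs_of_nonneg (mul_nonneg (mul_nonneg hC0 hM0) (abs_nonneg _))]
      ring
  have h5 : ∫ᵛ x, u x ∂•(ν t) - ∫ᵛ x, u (x + W.displacement s t x) ∂•(ν s) =
      (∫ᵛ x, u x ∂•(ν t) - ∫ᵛ x, u x ∂•(ν s) -
        ∫ᵛ x, fderiv ℝ u x (W.displacement s t x) ∂•(ν s)) -
      (∫ᵛ x, u (x + W.displacement s t x) ∂•(ν s) - ∫ᵛ x, u x ∂•(ν s) -
        ∫ᵛ x, fderiv ℝ u x (W.displacement s t x) ∂•(ν s)) := by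
    ring
  rw [h5]
  refine (abs_sub _ _).trans ((add_le_add hmain htay).trans_eq ?_)
  ring

/-- Iteration of the Euler steps: up to a small error, the integral of a test function against a
solution of (PDE) is determined by the initial value of the solution. -/
theorem exists_abs_integral_sub_le (hT : 0 ≤ T) {W : SmoothField d} {e b : ℝ → ℝ} {n : ℕ}
    (he : Integrable e) (he0 : ∀ t, 0 ≤ e t)
    (hb : Integrable b) (hWb : ∀ t x, ‖W.eval t x‖ ≤ b t)
    (hVW : ∀ᵐ t, ∀ x, ‖x‖ ≤ n → ‖V t x - W.eval t x‖ ≤ e t) {S σ : ℝ} (hσ : |σ| ≤ T) (j : ℕ)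
    (hj : ∀ i ≤ j, S + i * σ ∈ Icc 0 T) {u : Rd d → ℝ} {R ℓ q : ℝ}
    (h : TestBounds u R ℓ q) (hℓ : 0 ≤ ℓ) (hq : 0 ≤ q) (hR : R + |∫ r in S..S + j * σ, b r| ≤ n) :
    ∃ w : Rd d → ℝ, ∀ (ν : ℝ → SignedMeasure (Rd d)) (M : ℝ), IsPDESolution T V ν →
      (∀ t ∈ Icc 0 T, (ν t).variation.real univ ≤ M) →
      |∫ᵛ x, u x ∂•(ν (S + j * σ)) - ∫ᵛ x, w x ∂•(ν S)| ≤
        M * (ℓ * (1 + |σ| * W.lip) ^ j * |∫ r in S..S + j * σ, e r| +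
          (ℓ + q) * (1 + |σ| * (2 * W.lip + T * W.lip ^ 2 + W.bound * W.Q)) ^ j *
            ((W.lip + W.bound + W.bound ^ 2) *
              (|σ| * |∫ r in S..S + j * σ, V.speed r| + j * |σ| ^ 2))) := by
  have hb0 : ∀ t, 0 ≤ b t := fun t => (norm_nonneg _).trans (hWb t 0)
  have hK := W.lip_nonneg
  have hB := W.bound_nonneg
  have hQ := W.Q_nonneg
  have hh := abs_nonneg σ
  set K := W.lip with hKdef
  set A := 1 + |σ| * K with hAdef
  set K₃ := 2 * K + T * K ^ 2 + W.bound * W.Q with hK₃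
  set A₃ := 1 + |σ| * K₃ with hA₃def
  set C := K + W.bound + W.bound ^ 2 with hCdef
  have hK₃0 : 0 ≤ K₃ := by positivity
  have hA : 1 ≤ A := le_add_of_nonneg_right (by positivity)
  have hA₃ : 1 ≤ A₃ := le_add_of_nonneg_right (by positivity)
  have hC0 : 0 ≤ C := by positivity
  -- The step nearest to the final time is removed first: it replaces `u` by its composition with
  -- that step, to which the induction hypothesis applies. The function `w` at time S is chosen
  -- before `ν`, hence is common to all solutions. The radius grows by at most the integral of `b`
  -- over the step.
  induction j generalizing u R ℓ q with
  | zero => exact ⟨u, fun ν M _ _ => by simp⟩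
  | succ j ih =>
    set s := S + j * σ with hs
    set t := S + (j + 1 : ℕ) * σ with ht
    have hts : t - s = σ := by
      rw [hs, ht]
      push_cast
      ring
    have hmem : s ∈ uIcc S t := by
      rcases le_total 0 σ with h0 | h0
      · exact mem_uIcc.2 (Or.inl ⟨by rw [hs]; nlinarith [(Nat.cast_nonneg j : (0 : ℝ) ≤ j)],
          by linarith⟩)
      · exact mem_uIcc.2 (Or.inr ⟨by linarith,
          by rw [hs]; nlinarith [(Nat.cast_nonneg j : (0 : ℝ) ≤ j)]⟩)
    have haddb := abs_intervalIntegral_add_abs hb hb0 hmem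
    have hadde := abs_intervalIntegral_add_abs he he0 hmem
    have haddv := abs_intervalIntegral_add_abs V.integrable_speed V.speed_nonneg hmem
    have hsI : s ∈ Icc 0 T := hj j (Nat.le_succ j)
    have htI : t ∈ Icc 0 T := hj (j + 1) le_rfl
    have hdisp : ∀ x, ‖W.displacement s t x‖ ≤ |∫ r in s..t, b r| := fun x => by
      rw [W.displacement_eq_integral]
      exact intervalIntegral.norm_integral_le_abs_of_norm_le
        (Eventually.of_forall fun r => hWb r x) hb.intervalIntegrable
    have h' := W.testBounds_comp_step h hℓ hq hdisp
    rw [hts, ← hKdef, mul_comm K, ← hAdef] at h'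
    set q' := q * A ^ 2 + ℓ * (W.bound * W.Q * |σ|) with hq'def
    have hq' : 0 ≤ q' := by positivity
    have hℓ' : 0 ≤ ℓ * A := by positivity
    obtain ⟨w, hw⟩ := ih (fun i hi => hj i (hi.trans (Nat.le_succ j))) h' hℓ' hq' (by linarith)
    refine ⟨w, fun ν M hν hM => ?_⟩
    have hM0 : 0 ≤ M := measureReal_nonneg.trans (hM s hsI)
    have h1 := hν.abs_integral_sub_step_le hT hM he he0 hb hWb hVW h hℓ hq
      (by linarith [abs_nonneg (∫ r in S..t, b r)]) hsI htI
    rw [hts, ← hKdef] at h1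
    refine (abs_sub_le _ _ _).trans ((add_le_add h1 (hw ν M hν hM)).trans ?_)
    rw [← mul_add]
    refine mul_le_mul_of_nonneg_left ?_ hM0
    rw [← hadde, ← haddv]
    set E₁ := |∫ r in S..s, e r|
    set E₂ := |∫ r in s..t, e r|
    set v₁ := |∫ r in S..s, V.speed r|
    set v₂ := |∫ r in s..t, V.speed r|
    have hE₂ : 0 ≤ E₂ := abs_nonneg _
    have hv₁ : 0 ≤ v₁ := abs_nonneg _
    have hv₂ : 0 ≤ v₂ := abs_nonneg _
    -- Each step multiplies ℓ by `A`, and the sum ℓ + q by at most `A₃`; the constant T in `K₃`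
    -- comes from |σ|² ≤ T|σ|. Only the growth of ℓ affects the error `e`.
    have hsum : ℓ * A + q' ≤ (ℓ + q) * A₃ := by
      have h2 : |σ| * (|σ| * K ^ 2) ≤ |σ| * (T * K ^ 2) :=
        mul_le_mul_of_nonneg_left (mul_le_mul_of_nonneg_right hσ (sq_nonneg K)) hh
      have h3 : A ^ 2 ≤ 1 + |σ| * (2 * K + T * K ^ 2) :=
        calc A ^ 2 = 1 + |σ| * (2 * K) + |σ| * (|σ| * K ^ 2) := by ring
          _ ≤ 1 + |σ| * (2 * K) + |σ| * (T * K ^ 2) := by gcongr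
          _ = 1 + |σ| * (2 * K + T * K ^ 2) := by ring
      have h4 : q * A ^ 2 ≤ q * (1 + |σ| * (2 * K + T * K ^ 2)) := mul_le_mul_of_nonneg_left h3 hq
      have h5 : ℓ * A ≤ ℓ * (1 + |σ| * (2 * K + T * K ^ 2)) :=
        mul_le_mul_of_nonneg_left ((le_self_pow₀ hA two_ne_zero).trans h3) hℓ
      have h6 : 0 ≤ q * (W.bound * W.Q * |σ|) := by positivity
      rw [hq'def, hA₃def, hK₃]
      linarith
    have hstep1 : ℓ * E₂ ≤ ℓ * A ^ (j + 1) * E₂ := by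
      exact mul_le_mul_of_nonneg_right (le_mul_of_one_le_right hℓ (one_le_pow₀ hA)) hE₂
    have hstep2 : (K * ℓ + W.bound * q) * (|σ| * v₂) + q * (W.bound * |σ|) ^ 2 ≤
        (ℓ + q) * A₃ ^ (j + 1) * (C * (|σ| * v₂ + |σ| ^ 2)) := by
      have h2 : (K * ℓ + W.bound * q) * (|σ| * v₂) ≤ ((ℓ + q) * C) * (|σ| * v₂) := by
        refine mul_le_mul_of_nonneg_right ?_ (mul_nonneg hh hv₂)
        rw [hCdef]
        have : 0 ≤ ℓ * W.bound + ℓ * W.bound ^ 2 + q * K + q * W.bound ^ 2 := by positivity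
        linarith
      have h3 : q * (W.bound * |σ|) ^ 2 ≤ ((ℓ + q) * C) * |σ| ^ 2 := by
        rw [hCdef]
        have : 0 ≤ (ℓ * (K + W.bound + W.bound ^ 2) + q * (K + W.bound)) * |σ| ^ 2 := by positivity
        linarith
      have h4 : 0 ≤ (ℓ + q) * (C * (|σ| * v₂ + |σ| ^ 2)) := by positivity
      have h5 := le_mul_of_one_le_right h4 (one_le_pow₀ hA₃ (n := j + 1))
      linarith
    have hstep3 : (ℓ * A + q') * A₃ ^ j * (C * (|σ| * v₁ + j * |σ| ^ 2)) ≤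
        (ℓ + q) * A₃ ^ (j + 1) * (C * (|σ| * v₁ + j * |σ| ^ 2)) := by
      refine mul_le_mul_of_nonneg_right ?_ (by positivity)
      rw [pow_succ']
      have := mul_le_mul_of_nonneg_right hsum (pow_nonneg (zero_le_one.trans hA₃) j)
      linarith
    push_cast
    have hexp : ℓ * A * A ^ j * E₁ = ℓ * A ^ (j + 1) * E₁ := by ring
    linarith

end IsPDESolution

end

/-! ### Uniqueness for (PDE) and genericity -/

section

variable {d : ℕ} {T : ℝ}

theorem one_add_mul_pow_le_exp {h K T : ℝ} {N : ℕ} (hh : 0 ≤ h) (hK : 0 ≤ K) (hN : N * h ≤ T) :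
    (1 + h * K) ^ N ≤ Real.exp (K * T) :=
  calc (1 + h * K) ^ N ≤ Real.exp (h * K) ^ N := by
        refine pow_le_pow_left₀ (by positivity) ?_ N
        rw [add_comm]
        exact Real.add_one_le_exp _
    _ = Real.exp (K * (N * h)) := by
        rw [← Real.exp_nat_mul]
        ring_nf
    _ ≤ Real.exp (K * T) := Real.exp_le_exp.2 (mul_le_mul_of_nonneg_left hN hK)

/-- Two norm-bounded solutions of (PDE) with the same value at one time are close in duality with
test functions, whenever the field is very close to a smooth one on a large ball. -/
theorem abs_integral_sub_le_of_mem_approxSet (hT : 0 ≤ T) {V : FieldSpace d T} {n : ℕ}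
    (hV : V ∈ approxSet d T n) {μ ν : ℝ → SignedMeasure (Rd d)} {M : ℝ}
    (hμ : IsPDESolution T V μ) (hν : IsPDESolution T V ν)
    (hMμ : ∀ t ∈ Icc 0 T, (μ t).variation.real univ ≤ M)
    (hMν : ∀ t ∈ Icc 0 T, (ν t).variation.real univ ≤ M) {S t : ℝ} (hS : S ∈ Icc 0 T)
    (ht : t ∈ Icc 0 T) (hS' : ν S = μ S) {u : Rd d → ℝ} {R ℓ q : ℝ} (h : TestBounds u R ℓ q)
    (hℓ : 0 ≤ ℓ) (hq : 0 ≤ q) (hR : R + ‖V‖ + 2 ≤ n) :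
    |∫ᵛ x, u x ∂•(ν t) - ∫ᵛ x, u x ∂•(μ t)| ≤ 2 * M * ℓ / (n + 1) := by
  obtain ⟨W, e, b, he, he0, heV, hVW, hb, hWb, hbV⟩ := exists_approximation hV
  have hM0 : 0 ≤ M := measureReal_nonneg.trans (hMμ S hS)
  have hK := W.lip_nonneg
  have hB := W.bound_nonneg
  have hQ := W.Q_nonneg
  set K₃ := 2 * W.lip + T * W.lip ^ 2 + W.bound * W.Q with hK₃
  have hK₃0 : 0 ≤ K₃ := by positivity
  set C := W.lip + W.bound + W.bound ^ 2 with hC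
  have hC0 : 0 ≤ C := by positivity
  have hb0 : ∀ r, 0 ≤ b r := fun r => (norm_nonneg _).trans (hWb r 0)
  have hexp1 : Real.exp (-(2 * W.lip * T)) ≤ 1 := Real.exp_le_one_iff.2 (by
    have : 0 ≤ 2 * W.lip * T := by positivity
    linarith)
  -- This constant may be huge, as it involves the second derivatives of `W`, but it does not depend
  -- on the number N of Euler steps, so its contribution D/N disappears as N → ∞.
  set D := 2 * M * ((ℓ + q) * Real.exp (K₃ * T) * (C * (T * ‖V‖ + T ^ 2))) with hD
  have key : ∀ N : ℕ, 0 < N →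
      |∫ᵛ x, u x ∂•(ν t) - ∫ᵛ x, u x ∂•(μ t)| ≤ 2 * M * ℓ / (n + 1) + D / N := by
    intro N hN
    have hN' : (0 : ℝ) < N := Nat.cast_pos.2 hN
    set σ := (t - S) / N with hσ
    have hNσ : N * σ = t - S := mul_div_cancel₀ _ hN'.ne'
    have hSt : S + N * σ = t := by rw [hNσ]; ring
    have htS : |t - S| ≤ T := abs_le.2 ⟨by linarith [ht.1, hS.2], by linarith [ht.2, hS.1]⟩
    have hNh : N * |σ| ≤ T := by
      rwa [← hNσ, abs_mul, abs_of_pos hN'] at htS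
    have hσT : |σ| ≤ T := (le_mul_of_one_le_left (abs_nonneg σ) (Nat.one_le_cast.2 hN)).trans hNh
    have hmem : ∀ i ≤ N, S + i * σ ∈ Icc 0 T := fun i hi => by
      have h1 : (i : ℝ) / N ∈ Icc 0 1 :=
        ⟨by positivity, (div_le_one hN').2 (Nat.cast_le.2 hi)⟩
      have h2 := (convex_Icc 0 T).add_smul_sub_mem hS ht h1
      rwa [smul_eq_mul, div_mul_eq_mul_div, ← mul_div_assoc'] at h2
    obtain ⟨w, hw⟩ := IsPDESolution.exists_abs_integral_sub_le (V := V) (S := S) (σ := σ) (n := n)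
      hT he he0 hb hWb hVW hσT N hmem h hℓ hq (by
        linarith [abs_intervalIntegral_le_integral hb hb0 S (S + N * σ)])
    have h1 := hw ν M hν hMν
    have h2 := hw μ M hμ hMμ
    rw [hSt, ← hK₃, ← hC] at h1 h2
    rw [hS'] at h1
    -- The growth exp(KT) of the differential is more than compensated by the bound exp(-2KT)/(n+1)
    -- on ∫e.
    have hA : ℓ * (1 + |σ| * W.lip) ^ N * |∫ r in S..t, e r| ≤ ℓ / (n + 1) := by
      have h3 := one_add_mul_pow_le_exp (abs_nonneg σ) hK hNh
      have h4 := (abs_intervalIntegral_le_integral he he0 S t).trans heV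
      calc ℓ * (1 + |σ| * W.lip) ^ N * |∫ r in S..t, e r|
          ≤ ℓ * Real.exp (W.lip * T) * (Real.exp (-(2 * W.lip * T)) / (n + 1)) := by gcongr
        _ = ℓ * Real.exp (-(W.lip * T)) / (n + 1) := by
            rw [mul_div_assoc', mul_assoc, ← Real.exp_add]
            ring_nf
        _ ≤ ℓ * 1 / (n + 1) := by
            gcongr
            exact Real.exp_le_one_iff.2 (neg_nonpos.2 (by positivity))
        _ = ℓ / (n + 1) := by rw [mul_one]
    have hB' : |σ| * |∫ r in S..t, V.speed r| + N * |σ| ^ 2 ≤ (T * ‖V‖ + T ^ 2) / N := by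
      have h3 : |σ| ≤ T / N := (le_div_iff₀' hN').2 hNh
      have h4 := V.abs_integral_speed_le S t
      calc |σ| * |∫ r in S..t, V.speed r| + N * |σ| ^ 2
          = |σ| * |∫ r in S..t, V.speed r| + (N * |σ|) * |σ| := by ring
        _ ≤ T / N * ‖V‖ + T * (T / N) := by gcongr
        _ = (T * ‖V‖ + T ^ 2) / N := by ring
    have hA₃ : (ℓ + q) * (1 + |σ| * K₃) ^ N *
        (C * (|σ| * |∫ r in S..t, V.speed r| + N * |σ| ^ 2)) ≤
        (ℓ + q) * Real.exp (K₃ * T) * (C * ((T * ‖V‖ + T ^ 2) / N)) := by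
      have h3 := one_add_mul_pow_le_exp (abs_nonneg σ) hK₃0 hNh
      gcongr
    have hfin := mul_le_mul_of_nonneg_left (add_le_add hA hA₃) hM0
    rw [abs_sub_comm] at h2
    -- Both solutions are compared with the same integral of `w` against their common value at S,
    -- whence the factor 2.
    refine (abs_sub_le _ _ _).trans ((add_le_add (h1.trans hfin) (h2.trans hfin)).trans_eq ?_)
    rw [hD]
    ring
  have hlim : Tendsto (fun N : ℕ => 2 * M * ℓ / (n + 1) + D / N) atTop
      (𝓝 (2 * M * ℓ / (n + 1) + 0)) :=
    tendsto_const_nhds.add (tendsto_const_div_atTop_nhds_zero_nat D)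
  rw [add_zero] at hlim
  refine ge_of_tendsto hlim ?_
  filter_upwards [eventually_gt_atTop 0] with N hN using key N hN

theorem variation_real_le_of_normBounded {μ : SignedMeasure (Rd d)} {C : ℝ≥0}
    (h : μ.variation univ ≤ C) : μ.variation.real univ ≤ C :=
  ENNReal.toReal_mono ENNReal.coe_ne_top h

/-- Norm-bounded solutions of (PDE) are unique if the field has very good approximations on all
balls. -/
theorem eq_of_isPDESolution (hT : 0 ≤ T) {V : FieldSpace d T} (hV : ∀ n, V ∈ approxSet d T n)
    {μ ν : ℝ → SignedMeasure (Rd d)} (hμ : IsPDESolution T V μ) (hν : IsPDESolution T V ν)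
    (hμb : NormBounded T μ) (hνb : NormBounded T ν) {S t : ℝ} (hS : S ∈ Icc 0 T)
    (ht : t ∈ Icc 0 T) (hS' : ν S = μ S) : ν t = μ t := by
  obtain ⟨C₁, hC₁⟩ := hμb
  obtain ⟨C₂, hC₂⟩ := hνb
  refine signedMeasure_ext_of_integral_contDiff fun u hu hc => ?_
  obtain ⟨R, ℓ, q, hℓ, hq, h⟩ := exists_testBounds hu hc
  rw [← sub_eq_zero, ← abs_nonpos_iff]
  have hlim : Tendsto (fun n : ℕ => 2 * max (C₁ : ℝ) C₂ * ℓ * (1 / ((n : ℝ) + 1))) atTop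
      (𝓝 (2 * max (C₁ : ℝ) C₂ * ℓ * 0)) := tendsto_one_div_add_atTop_nhds_zero_nat.const_mul _
  rw [mul_zero] at hlim
  refine ge_of_tendsto hlim ?_
  obtain ⟨m, hm⟩ := exists_nat_ge (R + ‖V‖ + 2)
  filter_upwards [eventually_ge_atTop m] with n hn
  rw [mul_one_div]
  exact abs_integral_sub_le_of_mem_approxSet hT (hV n) hμ hν
    (fun r hr => (variation_real_le_of_normBounded (hC₁ r hr)).trans (le_max_left _ _))
    (fun r hr => (variation_real_le_of_normBounded (hC₂ r hr)).trans (le_max_right _ _))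
    hS ht hS' h hℓ hq (hm.trans (Nat.cast_le.2 hn))

theorem uniquelySolvesPDE_flow {V : FieldSpace d T} (hV : ∀ n, V ∈ approxSet d T n) (hT : 0 ≤ T) :
    UniquelySolvesPDE T V (flow hV hT) := fun _ hS μ =>
  ⟨⟨isPDESolution_map_flow hV hT hS μ, normBounded_map T μ _, map_flow_self hV hT hS μ⟩,
    fun _ hν hνb hνS _ ht => eq_of_isPDESolution hT hV (isPDESolution_map_flow hV hT hS μ) hν
      (normBounded_map T μ _) hνb hS ht (hνS.trans (map_flow_self hV hT hS μ).symm)⟩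

theorem exists_flow_mem_residual (hT : 0 ≤ T) :
    {V : FieldSpace d T | ∃ X : ℝ → ℝ → Rd d → Rd d, IsFlow T V X ∧ UniquelySolvesPDE T V X} ∈
      residual (FieldSpace d T) := by
  have h : (⋂ n, approxSet d T n) ∈ residual (FieldSpace d T) := countable_iInter_mem.2 fun n =>
    residual_of_dense_open (isOpen_approxSet n) (dense_approxSet n)
  refine mem_of_superset h fun V hV => ?_
  have hV' := mem_iInter.1 hV
  exact ⟨flow hV' hT, isFlow_flow hV' hT, uniquelySolvesPDE_flow hV' hT⟩

end

end GenericFlow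

end

theorem theorem1 (d : ℕ) (T : ℝ) (hT : 0 < T) :
    CompleteSpace (GenericFlow.FieldSpace d T) ∧
      {V : GenericFlow.FieldSpace d T | ∃ X : ℝ → ℝ → GenericFlow.Rd d → GenericFlow.Rd d,
        GenericFlow.IsFlow T V X ∧ GenericFlow.UniquelySolvesPDE T V X} ∈
          residual (GenericFlow.FieldSpace d T) :=
  ⟨GenericFlow.completeSpace_fieldSpace, GenericFlow.exists_flow_mem_residual hT.le⟩
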